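/- **Ultragraphs.** An ultragraph $\mathcal U=(U^0,\mathcal U^1,r,s)$ consists of a set $U^0$ of vertices, a set $\mathcal U^1$ of edges and maps $r,s:\mathcal U^1\to P(U^0)\setminus\{\emptyset\}$ such that every $r(e)$ is a singleton. It is row-finite without sources if $\{e\in\mathcal U^1: r(e)=\{v\}\}$ is finite and nonempty for every $v\in U^0$. Let $\mathcal U^0$ be the smallest family of subsets of $U^0$ that contains $\emptyset$, all $\{v\}$ and all $s(e)$ and is closed under $\cap,\cup,\setminus$. A path of length $n\ge1$ is a sequence $\alpha=e_1\cdots e_n$ of edges with $r(e_{i+1})\subseteq s(e_i)$; put $r(\alpha)=r(e_1)$ and $s(\alpha)=s(e_n)$. Let $\mathcal U^{\ge1}$ be the set of these paths and $\mathcal U^\sharp=\mathcal U^{\ge1}\cup\{\omega\}$, where $\omega$ is a path of length zero with $\omega\alpha=\alpha\omega=\alpha$ and $r(\omega)=s(\omega)=U^0$. **Self-similar ultragraphs.** A self-similar ultragraph $(G,\mathcal U,\varphi)$ is a row-finite ultragraph $\mathcal U$ without sources, a discrete group $G$ acting on $U^0$ and on $\mathcal U^1$ with $r(g\cdot e)=g\cdot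 r(e)$ and $s(g\cdot e)=g\cdot s(e)$, and a map $\varphi:G\times\mathcal U^1\to G$ with $\varphi(gh,e)=\varphi(g,h\cdot e)\,\varphi(h,e)$ and $\varphi(g,e)\cdot s(e)\subseteq g\cdot s(e)$. Action and cocycle are extended to $\mathcal U^\sharp$ by $g\cdot\omega=\omega$, $\varphi(g,\omega)=g$, $g\cdot(e\alpha)=(g\cdot e)(\varphi(g,e)\cdot\alpha)$ and $\varphi(g,e\alpha)=\varphi(\varphi(g,e),\alpha)$. **The inverse semigroup.** $\mathcal S_{G,\mathcal U}$ consists of a zero element $0$ and all $(\alpha,A,g,\beta)$ with $\alpha,\beta\in\mathcal U^\sharp$, $g\in G$, $A\in\mathcal U^0$ and $\emptyset\ne A\subseteq s(\alpha)\cap g\cdot s(\beta)$. Its involution is $(\alpha,A,g,\beta)^*=(\beta,g^{-1}\cdot A,g^{-1},\alpha)$, $0^*=0$, and the product $(\alpha,A,g,\beta)(\gamma,B,h,\delta)$ is * $\big(\alpha(g\cdot\varepsilon),\ s(g\cdot\varepsilon)\cap(\varphi(g,\varepsilon)\cdot B),\ \varphi(g,\varepsilon)h,\ \delta\big)$ if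 $\gamma=\beta\varepsilon$ with $\varepsilon\in\mathcal U^{\ge1}$ and $g\cdot r(\varepsilon)\subseteq A$; * $\big(\alpha,\ A\cap(k\cdot s(h^{-1}\cdot\varepsilon)),\ k,\ \delta(h^{-1}\cdot\varepsilon)\big)$ with $k=g\,\varphi(h^{-1},\varepsilon)^{-1}$ if $\beta=\gamma\varepsilon$ with $\varepsilon\in\mathcal U^{\ge1}$ and $r(\varepsilon)\subseteq B$; * $(\alpha,\ A\cap(g\cdot B),\ gh,\ \delta)$ if $\gamma=\beta$ and $A\cap(g\cdot B)\neq\emptyset$; * $0$ otherwise (and whenever a factor is $0$). **The tight groupoid.** Let $S$ be an inverse semigroup with $0$, let $\mathcal E(S)$ be its set of idempotents, and write $s\le t$ if $s=te$ for some $e\in\mathcal E(S)$. A filter is a nonempty subset of $\mathcal E(S)$ that is closed under products and upward closed in $\mathcal E(S)$. The filters not containing $0$ form a space $\widehat{\mathcal E}_0(S)$, with the topology generated by the sets $\{\mathcal F: e\in\mathcal F,\ e_1,\dots,e_n\notin\mathcal F\}$ for $e,e_1,\dots,e_n\in\mathcal E(S)$, $n\ge 0$; ultrafilters are its maximal elements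 under inclusion. The tight spectrum $\widehat{\mathcal E}_{\rm tight}(S)$ is the closure of the set of ultrafilters in $\widehat{\mathcal E}_0(S)$. The tight groupoid $\mathcal G_{\rm tight}(S)$ is the set of germs $[s,\mathcal F]$ with $s\in S$, $\mathcal F\in\widehat{\mathcal E}_{\rm tight}(S)$ and $s^*s\in\mathcal F$, where $[s,\mathcal F]=[t,\mathcal F']$ iff $\mathcal F=\mathcal F'$ and $se=te$ for some $e\in\mathcal F$; its topology is generated by the sets $[s,W]=\{[s,\mathcal F]:\mathcal F\in W,\ s^*s\in\mathcal F\}$ with $s\in S$ and $W\subseteq\widehat{\mathcal E}_{\rm tight}(S)$ open. **Strongly fixed paths.** For $g\in G$ let $\mathbf{SF}_g$ be the set of $\alpha\in\mathcal U^{\ge1}$ with $g\cdot\alpha=\alpha$ and $\varphi(g,\alpha)=1_G$, and for $A\in\mathcal U^0$ let $A\mathbf{SF}_g=\{\gamma\in\mathbf{SF}_g:r(\gamma)\subseteq A\}$. An element of $A\mathbf{SF}_g$ is minimal if no other element of $A\mathbf{SF}_g$ is an initial subpath of it. **Theorem.** Let $(G,\mathcal U,\varphi)$ be a self-similar ultragraph.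 If for every $g\in G\setminus\{1_G\}$, all $v\in U^0$ and all $e\in\mathcal U^1$ the sets $\{v\}\mathbf{SF}_g$ and $s(e)\mathbf{SF}_g$ have only finitely many minimal elements, then $\mathcal G_{\rm tight}(\mathcal S_{G,\mathcal U})$ is Hausdorff. Conversely, if $\mathcal G_{\rm tight}(\mathcal S_{G,\mathcal U})$ is Hausdorff, then all these sets have only finitely many minimal elements. -/

import Mathlib

/-! ## Inverse semigroups with zero, tight filters, and the tight groupoid of germs -/

/-- An inverse semigroup with zero: every `s` has a unique generalized inverse `star s`. -/
class InverseSemigroupWithZero (S : Type*) extends SemigroupWithZero S, Star S where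
  mul_star_mul : ∀ s : S, s * star s * s = s
  star_mul_star : ∀ s : S, star s * s * star s = star s
  star_unique : ∀ s t : S, s * t * s = s → t * s * t = t → t = star s

namespace InverseSemigroupWithZero

variable {S : Type*} [InverseSemigroupWithZero S]

lemma star_eq_self {e : S} (he : IsIdempotentElem e) : star e = e :=
  (star_unique e e (by rw [he.eq, he.eq]) (by rw [he.eq, he.eq])).symm

lemma isIdempotentElem_mul {e f : S} (he : IsIdempotentElem e) (hf : IsIdempotentElem f) :
    IsIdempotentElem (e * f) := by
  have h1 := mul_star_mul (e * f)
  have h2 := star_mul_star (e * f)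
  set x := star (e * f)
  have he' : ∀ y : S, e * (e * y) = e * y := fun y => by rw [← mul_assoc, he.eq]
  have hf' : ∀ y : S, f * (f * y) = f * y := fun y => by rw [← mul_assoc, hf.eq]
  simp only [mul_assoc] at h1 h2
  have h2' : ∀ y : S, x * (e * (f * (x * y))) = x * y := fun y => by
    have := congrArg (· * y) h2
    simpa only [mul_assoc] using this
  have hfx : f * x * e = x := by
    refine star_unique (e * f) (f * x * e) ?_ ?_
    · simp only [mul_assoc, he', hf', h1]
    · simp only [mul_assoc, he', hf', h2']
  have hxi : IsIdempotentElem x := by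
    have : f * x * e * (f * x * e) = f * x * e := by
      simp only [mul_assoc, h2']
    rwa [hfx] at this
  have : e * f = star x := star_unique x (e * f) (by simpa only [mul_assoc] using h2)
    (by simpa only [mul_assoc] using h1)
  rw [star_eq_self hxi] at this
  rw [this]
  exact hxi

/-- Idempotents of an inverse semigroup commute. -/
lemma idem_comm {e f : S} (he : IsIdempotentElem e) (hf : IsIdempotentElem f) :
    e * f = f * e := by
  have he' : ∀ y : S, e * (e * y) = e * y := fun y => by rw [← mul_assoc, he.eq]
  have hf' : ∀ y : S, f * (f * y) = f * y := fun y => by rw [← mul_assoc, hf.eq]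
  have h1 := (isIdempotentElem_mul he hf).eq
  have h2 := (isIdempotentElem_mul hf he).eq
  simp only [mul_assoc] at h1 h2
  have : f * e = star (e * f) := by
    apply star_unique
    · simp only [mul_assoc, he', hf', h1]
    · simp only [mul_assoc, he', hf', h2]
  rw [this, star_eq_self (isIdempotentElem_mul he hf)]

/-- The natural partial order: `s ≤ t` iff `s = t e` for some idempotent `e`. -/
def NatLE (s t : S) : Prop := ∃ e : S, IsIdempotentElem e ∧ s = t * e

/-- Filters in the semilattice of idempotents: nonempty sets of idempotents, closed under
products and upward closed among the idempotents. -/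
structure IsFilter (F : Set S) : Prop where
  nonempty : F.Nonempty
  idem : ∀ e ∈ F, IsIdempotentElem e
  mul_mem : ∀ e ∈ F, ∀ f ∈ F, e * f ∈ F
  up_mem : ∀ e ∈ F, ∀ f : S, IsIdempotentElem f → NatLE e f → f ∈ F

variable (S) in
/-- The space of all filters without `0`. -/
def FilterSpace : Type _ := {F : Set S // IsFilter F ∧ (0 : S) ∉ F}

/-- The set `N(e; e₁, …, eₙ)`, with `T = {e₁, …, eₙ}`, of filters containing `e` and none of the
`eᵢ`. -/
def basicNhd (e : S) (T : Finset S) : Set (FilterSpace S) :=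
  {F | e ∈ F.1 ∧ ∀ f ∈ T, f ∉ F.1}

/-- The topology generated by the sets `N(e; e₁, …, eₙ)`, for idempotents `e, e₁, …, eₙ`. -/
instance : TopologicalSpace (FilterSpace S) :=
  TopologicalSpace.generateFrom
    {N | ∃ (e : S) (T : Finset S), IsIdempotentElem e ∧ (∀ f ∈ T, IsIdempotentElem f) ∧
      N = basicNhd e T}

variable (S) in
/-- The ultrafilters: maximal elements among the filters without `0`. (A filter is proper iff it
does not contain `0`.) -/
def ultrafilters : Set (FilterSpace S) :=
  {F | ∀ F' : FilterSpace S, F.1 ⊆ F'.1 → F'.1 = F.1}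

variable (S) in
/-- The tight spectrum: the closure of the ultrafilters, with the subspace topology. -/
def TightSpectrum : Type _ := {F : FilterSpace S // F ∈ closure (ultrafilters S)}

instance : TopologicalSpace (TightSpectrum S) :=
  inferInstanceAs (TopologicalSpace {F : FilterSpace S // F ∈ closure (ultrafilters S)})

/-- The underlying set of idempotents of a tight filter. -/
def TightSpectrum.carrier (F : TightSpectrum S) : Set S := F.1.1

variable (S) in
/-- The pairs `(s, F)` with `F` a tight filter containing `s* s`. -/
structure GermPair where
  elt : S
  filter : TightSpectrum S
  mem : star elt * elt ∈ filter.carrier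

variable (S) in
/-- `(s, F) ∼ (t, F')` iff `F = F'` and `s e = t e` for some `e ∈ F`. -/
instance germSetoid : Setoid (GermPair S) where
  r p q := p.filter = q.filter ∧ ∃ e ∈ p.filter.carrier, p.elt * e = q.elt * e
  iseqv :=
    { refl := fun p => ⟨rfl, _, p.mem, rfl⟩
      symm := fun {p q} ⟨h, e, he, h'⟩ => ⟨h.symm, e, h ▸ he, h'.symm⟩
      trans := fun {p q r} ⟨h, e, he, h'⟩ ⟨k, f, hf, k'⟩ => by
        rw [← h] at hf
        have hF : IsFilter p.filter.carrier := p.filter.1.2.1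
        refine ⟨h.trans k, e * f, hF.mul_mem _ he _ hf, ?_⟩
        rw [← mul_assoc, h', mul_assoc, idem_comm (hF.idem _ he) (hF.idem _ hf), ← mul_assoc, k',
          mul_assoc] }

variable (S) in
/-- The tight groupoid of germs (as a space; its algebraic operations are not needed to speak of
its topology). Its elements are the germs `[s, F]`. -/
def TightGroupoid : Type _ := Quotient (germSetoid S)

/-- The set `[s, W]` of the germs `[s, F]` with `F ∈ W`. -/
def germSet (s : S) (W : Set (TightSpectrum S)) : Set (TightGroupoid S) :=
  {x | ∃ p : GermPair S, p.elt = s ∧ p.filter ∈ W ∧ x = Quotient.mk (germSetoid S) p}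

/-- The topology generated by the sets `[s, W]` with `s ∈ S` and `W` open in the tight spectrum. -/
instance : TopologicalSpace (TightGroupoid S) :=
  TopologicalSpace.generateFrom
    {O | ∃ (s : S) (W : Set (TightSpectrum S)), IsOpen W ∧ O = germSet s W}

end InverseSemigroupWithZero

/-! ## Self-similar ultragraphs -/

/-- An ultragraph with vertex set `V` and edge set `E`: each edge has a range, which is a single
vertex `rng e` (so `r(e) = {rng e}`), and a source, which is a nonempty set of vertices. -/
structure Ultragraph (V E : Type*) where
  rng : E → V
  src : E → Set V
  src_nonempty : ∀ e, (src e).Nonempty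

namespace Ultragraph

variable {V E : Type*} (U : Ultragraph V E)

/-- Every vertex receives finitely many edges. -/
def RowFinite : Prop := ∀ v, {e | U.rng e = v}.Finite

/-- Every vertex receives at least one edge. -/
def NoSources : Prop := ∀ v, {e | U.rng e = v}.Nonempty

/-- `U.Gen A` says that `A` belongs to the smallest family of vertex sets that contains `∅`, the
singletons and the sets `s(e)`, and is closed under `∩`, `∪` and set difference. -/
inductive Gen : Set V → Prop
  | empty : Gen ∅
  | singleton (v : V) : Gen {v}
  | source (e : E) : Gen (U.src e)
  | inter {A B : Set V} : Gen A → Gen B → Gen (A ∩ B)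
  | union {A B : Set V} : Gen A → Gen B → Gen (A ∪ B)
  | diff {A B : Set V} : Gen A → Gen B → Gen (A \ B)

/-- A list of edges `e₁ … eₙ` with `r(eᵢ₊₁) ⊆ s(eᵢ)`. The empty list is the universal zero-length
path `ω`, and concatenation of lists is juxtaposition of paths. -/
def IsPath (l : List E) : Prop := l.IsChain (fun e f => U.rng f ∈ U.src e)

/-- The range of a path, `r(e₁ … eₙ) = r(e₁)`, with `r(ω)` the set of all vertices. -/
def pathRng : List E → Set V
  | [] => Set.univ
  | e :: _ => {U.rng e}

/-- The source of a path, `s(e₁ … eₙ) = s(eₙ)`, with `s(ω)` the set of all vertices. -/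
def pathSrc (l : List E) : Set V :=
  match l.getLast? with
  | none => Set.univ
  | some e => U.src e

lemma pathSrc_concat (l : List E) (e : E) : U.pathSrc (l ++ [e]) = U.src e := by
  simp [pathSrc]

lemma pathSrc_append (l : List E) {m : List E} (hm : m ≠ []) :
    U.pathSrc (l ++ m) = U.pathSrc m := by
  obtain rfl | ⟨m', e, rfl⟩ := m.eq_nil_or_concat
  · exact absurd rfl hm
  · rw [List.concat_eq_append, ← List.append_assoc, pathSrc_concat, pathSrc_concat]

lemma gen_pathSrc {l : List E} (hl : l ≠ []) : U.Gen (U.pathSrc l) := by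
  obtain rfl | ⟨m', e, rfl⟩ := l.eq_nil_or_concat
  · exact absurd rfl hl
  · rw [List.concat_eq_append, pathSrc_concat]
    exact Gen.source e

lemma IsPath.append {l m : List E} (hl : U.IsPath l) (hm : U.IsPath m)
    (h : U.pathRng m ⊆ U.pathSrc l) : U.IsPath (l ++ m) := by
  refine List.IsChain.append hl hm ?_
  intro x hx y hy
  cases m with
  | nil => simp at hy
  | cons e m =>
    simp only [List.head?_cons, Option.mem_def, Option.some.injEq] at hy
    subst hy
    have : U.pathSrc l = U.src x := by
      unfold pathSrc
      rw [Option.mem_def.1 hx]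
    rw [this] at h
    exact h rfl

end Ultragraph

open scoped Pointwise in
/-- A self-similar ultragraph: a group `G` acting by automorphisms on a row-finite ultragraph
without sources, and a 1-cocycle `φ : G × E → G` with `φ(g, e) · s(e) ⊆ g · s(e)`. -/
structure SelfSimilarUltragraph (G V E : Type*) [Group G] [MulAction G V] [MulAction G E]
    extends Ultragraph V E where
  rowFinite : toUltragraph.RowFinite
  noSources : toUltragraph.NoSources
  rng_smul : ∀ (g : G) (e : E), rng (g • e) = g • rng e
  src_smul : ∀ (g : G) (e : E), src (g • e) = g • src e
  φ : G → E → G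
  φ_mul : ∀ (g h : G) (e : E), φ (g * h) e = φ g (h • e) * φ h e
  φ_smul_src : ∀ (g : G) (e : E), φ g e • src e ⊆ g • src e

namespace SelfSimilarUltragraph

open scoped Pointwise

variable {G V E : Type*} [Group G] [MulAction G V] [MulAction G E]
  (U : SelfSimilarUltragraph G V E)

/-- The extended action on paths: `g · (e α) = (g · e) (φ(g, e) · α)` and `g · ω = ω`. -/
def act : G → List E → List E
  | _, [] => []
  | g, e :: l => (g • e) :: act (U.φ g e) l

/-- The extended cocycle on paths: `φ(g, e α) = φ(φ(g, e), α)` and `φ(g, ω) = g`. -/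
def coc : G → List E → G
  | g, [] => g
  | g, e :: l => coc (U.φ g e) l

/-- The set of paths of positive length that are strongly fixed by `g`. -/
def SF (g : G) : Set (List E) :=
  {α | α ≠ [] ∧ U.IsPath α ∧ U.act g α = α ∧ U.coc g α = 1}

/-- The strongly fixed paths by `g` with range contained in `A`. -/
def SFIn (A : Set V) (g : G) : Set (List E) := {γ | γ ∈ U.SF g ∧ U.pathRng γ ⊆ A}

/-- The minimal elements of a set of paths: those with no other member of the set as an initial
subpath. -/
def minimalPaths (X : Set (List E)) : Set (List E) :=
  {γ | γ ∈ X ∧ ∀ τ ∈ X, τ <+: γ → τ = γ}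

/-! ### Properties of the extended action and cocycle -/

lemma φ_one (e : E) : U.φ 1 e = 1 := by
  have := U.φ_mul 1 1 e
  simpa using this

lemma φ_smul_src_eq (g : G) (e : E) : U.φ g e • U.src e = g • U.src e := by
  refine (U.φ_smul_src g e).antisymm ?_
  have h := U.φ_smul_src g⁻¹ (g • e)
  have h1 : U.φ g⁻¹ (g • e) = (U.φ g e)⁻¹ := by
    have := U.φ_mul g⁻¹ g e
    rw [inv_mul_cancel, φ_one] at this
    exact eq_inv_of_mul_eq_one_left this.symm
  rw [h1, U.src_smul, inv_smul_smul] at h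
  exact Set.subset_smul_set_iff.2 h

@[simp] lemma act_nil (g : G) : U.act g [] = [] := rfl

@[simp] lemma coc_nil (g : G) : U.coc g [] = g := rfl

@[simp] lemma act_cons (g : G) (e : E) (l : List E) :
    U.act g (e :: l) = (g • e) :: U.act (U.φ g e) l := rfl

@[simp] lemma coc_cons (g : G) (e : E) (l : List E) :
    U.coc g (e :: l) = U.coc (U.φ g e) l := rfl

lemma act_one (l : List E) : U.act 1 l = l := by
  induction l with
  | nil => rfl
  | cons e l ih => simp [φ_one, ih]

lemma coc_one (l : List E) : U.coc 1 l = 1 := by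
  induction l with
  | nil => rfl
  | cons e l ih => simp [φ_one, ih]

lemma act_append (g : G) (l m : List E) :
    U.act g (l ++ m) = U.act g l ++ U.act (U.coc g l) m := by
  induction l generalizing g with
  | nil => rfl
  | cons e l ih => simp [ih]

lemma coc_append (g : G) (l m : List E) :
    U.coc g (l ++ m) = U.coc (U.coc g l) m := by
  induction l generalizing g with
  | nil => rfl
  | cons e l ih => simp [ih]

lemma act_mul (g h : G) (l : List E) : U.act (g * h) l = U.act g (U.act h l) := by
  induction l generalizing g h with
  | nil => rfl
  | cons e l ih => simp [mul_smul, U.φ_mul, ih]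

lemma coc_mul (g h : G) (l : List E) :
    U.coc (g * h) l = U.coc g (U.act h l) * U.coc h l := by
  induction l generalizing g h with
  | nil => rfl
  | cons e l ih => simp [U.φ_mul, ih]

lemma act_ne_nil {g : G} {l : List E} (hl : l ≠ []) : U.act g l ≠ [] := by
  cases l with
  | nil => exact absurd rfl hl
  | cons e l => simp

lemma coc_inv_act (g : G) (l : List E) : U.coc g⁻¹ (U.act g l) = (U.coc g l)⁻¹ := by
  have := U.coc_mul g⁻¹ g l
  rw [inv_mul_cancel, coc_one] at this
  exact eq_inv_of_mul_eq_one_left this.symm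

lemma coc_act_inv (g : G) (l : List E) : U.coc g (U.act g⁻¹ l) = (U.coc g⁻¹ l)⁻¹ := by
  simpa using U.coc_inv_act g⁻¹ l

lemma act_inv_act (g : G) (l : List E) : U.act g⁻¹ (U.act g l) = l := by
  rw [← act_mul, inv_mul_cancel, act_one]

lemma act_act_inv (g : G) (l : List E) : U.act g (U.act g⁻¹ l) = l := by
  rw [← act_mul, mul_inv_cancel, act_one]

lemma isPath_act {g : G} {l : List E} (hl : U.IsPath l) : U.IsPath (U.act g l) := by
  induction l generalizing g with
  | nil => exact List.isChain_nil
  | cons e l ih =>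
    cases l with
    | nil => exact List.isChain_singleton _
    | cons f l =>
      have h := List.isChain_cons_cons.1 hl
      refine List.isChain_cons_cons.2 ⟨?_, ih (g := U.φ g e) h.2⟩
      rw [U.rng_smul, U.src_smul, ← U.φ_smul_src_eq]
      exact Set.smul_mem_smul_set h.1

lemma pathRng_act (g : G) (l : List E) : U.pathRng (U.act g l) = g • U.pathRng l := by
  cases l with
  | nil => simp [Ultragraph.pathRng]
  | cons e l => simp [Ultragraph.pathRng, U.rng_smul]

lemma pathSrc_act (g : G) (l : List E) :
    U.pathSrc (U.act g l) = U.coc g l • U.pathSrc l := by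
  obtain rfl | ⟨m, e, rfl⟩ := l.eq_nil_or_concat
  · simp [Ultragraph.pathSrc]
  · rw [List.concat_eq_append, act_append, coc_append, act_cons, act_nil, coc_cons, coc_nil,
      Ultragraph.pathSrc_concat, Ultragraph.pathSrc_concat, U.src_smul, U.φ_smul_src_eq]

lemma gen_smul (g : G) {A : Set V} (hA : U.Gen A) : U.Gen (g • A) := by
  induction hA with
  | empty => simpa using Ultragraph.Gen.empty
  | singleton v => simpa using Ultragraph.Gen.singleton (g • v)
  | source e => rw [← U.src_smul]; exact Ultragraph.Gen.source _
  | inter _ _ h1 h2 => rw [Set.smul_set_inter]; exact h1.inter h2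
  | union _ _ h1 h2 => rw [Set.smul_set_union]; exact h1.union h2
  | diff _ _ h1 h2 => rw [Set.smul_set_sdiff]; exact h1.diff h2

/-! ### The inverse semigroup -/

/-- The condition on `(α, A, g, β)` to be a nonzero element of the inverse semigroup: `α` and `β`
are paths of positive length or `ω`, and `A` is a generalized vertex with
`∅ ≠ A ⊆ s(α) ∩ g · s(β)`. -/
structure Valid (α : List E) (A : Set V) (g : G) (β : List E) : Prop where
  path_left : U.IsPath α
  path_right : U.IsPath β
  gen : U.Gen A
  nonempty : A.Nonempty
  subset : A ⊆ U.pathSrc α ∩ g • U.pathSrc β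

/-- The inverse semigroup of a self-similar ultragraph: the quadruples `(α, A, g, β)` as in
`Valid`, together with a zero. -/
inductive Semi
  | zero : Semi
  | elt (α : List E) (A : Set V) (g : G) (β : List E) (h : U.Valid α A g β) : Semi

variable {U}

lemma Valid.ext_right {α β γ δ ε : List E} {A B : Set V} {g h : G}
    (s : U.Valid α A g β) (t : U.Valid γ B h δ)
    (hc : γ = β ++ ε ∧ ε ≠ [] ∧ g • U.pathRng ε ⊆ A) :
    U.Valid (α ++ U.act g ε) (U.pathSrc (U.act g ε) ∩ U.coc g ε • B) (U.coc g ε * h) δ := by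
  obtain ⟨rfl, hε, hr⟩ := hc
  have hB : B ⊆ U.pathSrc ε := by
    have := t.subset.trans Set.inter_subset_left
    rwa [Ultragraph.pathSrc_append _ _ hε] at this
  have hB' : U.coc g ε • B ⊆ U.pathSrc (U.act g ε) := by
    rw [pathSrc_act]
    exact Set.smul_set_mono hB
  refine ⟨?_, t.path_right, ?_, ?_, ?_⟩
  · refine Ultragraph.IsPath.append _ s.path_left
      (U.isPath_act (List.IsChain.right_of_append t.path_left)) ?_
    rw [pathRng_act]
    exact hr.trans (s.subset.trans Set.inter_subset_left)
  · exact (U.gen_pathSrc (U.act_ne_nil hε)).inter (U.gen_smul _ t.gen)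
  · rw [Set.inter_eq_right.2 hB']
    exact t.nonempty.smul_set
  · rw [Ultragraph.pathSrc_append _ _ (U.act_ne_nil hε), mul_smul]
    exact Set.inter_subset_inter_right _
      (Set.smul_set_mono (t.subset.trans Set.inter_subset_right))

lemma Valid.subset_ext {α β γ ε : List E} {A : Set V} {g : G} (h : G)
    (s : U.Valid α A g β) (hc : β = γ ++ ε ∧ ε ≠ []) :
    A ⊆ (g * (U.coc h⁻¹ ε)⁻¹) • U.pathSrc (U.act h⁻¹ ε) := by
  obtain ⟨rfl, hε⟩ := hc
  have := s.subset.trans Set.inter_subset_right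
  rw [Ultragraph.pathSrc_append _ _ hε] at this
  rwa [pathSrc_act, mul_smul, inv_smul_smul]

lemma Valid.ext_left {α β γ δ ε : List E} {A B : Set V} {g h : G}
    (s : U.Valid α A g β) (t : U.Valid γ B h δ)
    (hc : β = γ ++ ε ∧ ε ≠ [] ∧ U.pathRng ε ⊆ B) :
    U.Valid α (A ∩ (g * (U.coc h⁻¹ ε)⁻¹) • U.pathSrc (U.act h⁻¹ ε))
      (g * (U.coc h⁻¹ ε)⁻¹) (δ ++ U.act h⁻¹ ε) := by
  have hA := s.subset_ext h ⟨hc.1, hc.2.1⟩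
  obtain ⟨rfl, hε, hr⟩ := hc
  refine ⟨s.path_left, ?_, ?_, ?_, ?_⟩
  · refine Ultragraph.IsPath.append _ t.path_right
      (U.isPath_act (List.IsChain.right_of_append s.path_right)) ?_
    rw [pathRng_act, ← Set.subset_smul_set_iff]
    exact hr.trans (t.subset.trans Set.inter_subset_right)
  · exact s.gen.inter (U.gen_smul _ (U.gen_pathSrc (U.act_ne_nil hε)))
  · rw [Set.inter_eq_left.2 hA]
    exact s.nonempty
  · rw [Ultragraph.pathSrc_append _ _ (U.act_ne_nil hε)]
    exact Set.inter_subset_inter_left _ (s.subset.trans Set.inter_subset_left)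

lemma Valid.ext_same {α β γ δ : List E} {A B : Set V} {g h : G}
    (s : U.Valid α A g β) (t : U.Valid γ B h δ) (hc : γ = β ∧ (A ∩ g • B).Nonempty) :
    U.Valid α (A ∩ g • B) (g * h) δ := by
  refine ⟨s.path_left, t.path_right, s.gen.inter (U.gen_smul _ t.gen), hc.2, ?_⟩
  rw [mul_smul]
  exact Set.inter_subset_inter (s.subset.trans Set.inter_subset_left)
    (Set.smul_set_mono (t.subset.trans Set.inter_subset_right))

lemma Valid.star {α β : List E} {A : Set V} {g : G} (s : U.Valid α A g β) :
    U.Valid β (g⁻¹ • A) g⁻¹ α := by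
  refine ⟨s.path_right, s.path_left, U.gen_smul _ s.gen, s.nonempty.smul_set, ?_⟩
  refine Set.subset_inter ?_ (Set.smul_set_mono (s.subset.trans Set.inter_subset_left))
  rw [← Set.subset_smul_set_iff]
  exact s.subset.trans Set.inter_subset_right

namespace Semi

instance : Zero (Semi U) := ⟨Semi.zero⟩

open Classical in
/-- The product of `(α, A, g, β)` and `(γ, B, h, δ)` is
* `(α (g · ε), s(g · ε) ∩ φ(g, ε) · B, φ(g, ε) h, δ)` if `γ = β ε` with `ε ≠ ω` and
  `g · r(ε) ⊆ A`;
* `(α, A ∩ k · s(h⁻¹ · ε), k, δ (h⁻¹ · ε))` with `k = g φ(h⁻¹, ε)⁻¹` if `β = γ ε` with `ε ≠ ω`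
  and `r(ε) ⊆ B`;
* `(α, A ∩ g · B, g h, δ)` if `γ = β` and `A ∩ g · B ≠ ∅`;
* zero otherwise.

In the first two cases `ε` is what remains of the longer path when the shorter one is dropped. -/
noncomputable def mul : Semi U → Semi U → Semi U
  | zero, _ => zero
  | elt _ _ _ _ _, zero => zero
  | elt α A g β s, elt γ B h δ t =>
    if h1 : γ = β ++ γ.drop β.length ∧ γ.drop β.length ≠ [] ∧
        g • U.pathRng (γ.drop β.length) ⊆ A then
      elt (α ++ U.act g (γ.drop β.length))
        (U.pathSrc (U.act g (γ.drop β.length)) ∩ U.coc g (γ.drop β.length) • B)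
        (U.coc g (γ.drop β.length) * h) δ (s.ext_right t h1)
    else if h2 : β = γ ++ β.drop γ.length ∧ β.drop γ.length ≠ [] ∧
        U.pathRng (β.drop γ.length) ⊆ B then
      elt α
        (A ∩ (g * (U.coc h⁻¹ (β.drop γ.length))⁻¹) • U.pathSrc (U.act h⁻¹ (β.drop γ.length)))
        (g * (U.coc h⁻¹ (β.drop γ.length))⁻¹) (δ ++ U.act h⁻¹ (β.drop γ.length))
        (s.ext_left t h2)
    else if h3 : γ = β ∧ (A ∩ g • B).Nonempty then
      elt α (A ∩ g • B) (g * h) δ (s.ext_same t h3)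
    else zero

noncomputable instance : Mul (Semi U) := ⟨mul⟩

/-- `(α, A, g, β)* = (β, g⁻¹ · A, g⁻¹, α)`. -/
instance : Star (Semi U) :=
  ⟨fun x => match x with
    | zero => zero
    | elt α A g β h => elt β (g⁻¹ • A) g⁻¹ α h.star⟩

/-! The semigroup laws are proved by letting the elements act as partial bijections. -/

/-- The first vertex of the word `ε` followed by the vertex `v`. -/
def hd (U : SelfSimilarUltragraph G V E) : List E → V → V
  | [], v => v
  | e :: _, _ => U.rng e

lemma hd_append (ε μ : List E) (v : V) (hε : ε ≠ []) (w : V) : hd U (ε ++ μ) v = hd U ε w := by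
  cases ε with
  | nil => exact absurd rfl hε
  | cons e l => rfl

lemma hd_act (g : G) (ε : List E) (v : V) : hd U (U.act g ε) (U.coc g ε • v) = g • hd U ε v := by
  cases ε with
  | nil => rfl
  | cons e l => exact U.rng_smul g e

lemma pathRng_subset {ε : List E} (hε : ε ≠ []) (v : V) (A : Set V) :
    U.pathRng ε ⊆ A ↔ hd U ε v ∈ A := by
  cases ε with
  | nil => exact absurd rfl hε
  | cons e l => simp [Ultragraph.pathRng, hd]

lemma smul_pathRng_subset {ε : List E} (hε : ε ≠ []) (v : V) (g : G) (A : Set V) :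
    g • U.pathRng ε ⊆ A ↔ g • hd U ε v ∈ A := by
  cases ε with
  | nil => exact absurd rfl hε
  | cons e l => simp [Ultragraph.pathRng, hd]

/-- The partial bijection of an element of the semigroup, as a relation. -/
def Rel : Semi U → List E × V × G → List E × V × G → Prop
  | zero, _, _ => False
  | elt α A g β _, x, y => ∃ ε, x.1 = β ++ ε ∧ g • hd U ε x.2.1 ∈ A ∧
      y = (α ++ U.act g ε, U.coc g ε • x.2.1, U.coc g ε * x.2.2)

lemma rel_fun {s : Semi U} {x y z : List E × V × G} (h1 : s.Rel x y) (h2 : s.Rel x z) :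
    y = z := by
  cases s with
  | zero => exact h1.elim
  | elt α A g β h =>
    obtain ⟨ε, hx, -, rfl⟩ := h1
    obtain ⟨ε', hx', -, rfl⟩ := h2
    obtain rfl : ε = ε' := List.append_cancel_left (hx.symm.trans hx')
    rfl

lemma star_star (s : Semi U) : star (star s) = s := by
  cases s with
  | zero => rfl
  | elt α A g β h =>
    change elt α (g⁻¹⁻¹ • g⁻¹ • A) g⁻¹⁻¹ β _ = elt α A g β h
    congr 1
    · simp
    · simp

lemma rel_star_of {s : Semi U} {x y : List E × V × G} (h : s.Rel x y) : (star s).Rel y x := by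
  cases s with
  | zero => exact h.elim
  | elt α A g β hv =>
    obtain ⟨ε, hx, hA, rfl⟩ := h
    refine ⟨U.act g ε, rfl, ?_, ?_⟩
    · rw [hd_act]
      exact Set.smul_mem_smul_set hA
    · obtain ⟨x1, x2, x3⟩ := x
      simp only at hx
      simp [act_inv_act, coc_inv_act, hx]

lemma rel_star {s : Semi U} {x y : List E × V × G} : (star s).Rel y x ↔ s.Rel x y :=
  ⟨fun h => by simpa [star_star] using rel_star_of h, rel_star_of⟩

lemma rel_inj {s : Semi U} {x y z : List E × V × G} (h1 : s.Rel x z) (h2 : s.Rel y z) :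
    x = y := rel_fun (rel_star.2 h1) (rel_star.2 h2)

lemma rel_base {α β : List E} {A : Set V} {g : G} (h : U.Valid α A g β) {v : V} (hv : g • v ∈ A) :
    (elt α A g β h).Rel (β, v, 1) (α, g • v, g) :=
  ⟨[], by simp, hv, by simp⟩

lemma rel_ext {s t : Semi U} (h : ∀ x y, s.Rel x y ↔ t.Rel x y) : s = t := by
  cases s with
  | zero =>
    cases t with
    | zero => rfl
    | elt γ B k δ ht =>
      obtain ⟨w, hw⟩ := ht.nonempty
      exact ((h _ _).2 (rel_base ht (v := k⁻¹ • w) (by simpa using hw))).elim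
  | elt α A g β hs =>
    cases t with
    | zero =>
      obtain ⟨w, hw⟩ := hs.nonempty
      exact ((h _ _).1 (rel_base hs (v := g⁻¹ • w) (by simpa using hw))).elim
    | elt γ B k δ ht =>
      obtain ⟨v, hv⟩ := hs.nonempty
      obtain ⟨w, hw⟩ := ht.nonempty
      have h1 : ∀ v, v ∈ A → ∃ ε, β = δ ++ ε ∧ k • hd U ε (g⁻¹ • v) ∈ B ∧
          α = γ ++ U.act k ε ∧ g = U.coc k ε := by
        intro v hv
        obtain ⟨ε, h1, h2, h3⟩ := (h _ _).1 (rel_base hs (v := g⁻¹ • v) (by simpa using hv))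
        simp only [Prod.mk.injEq, mul_one] at h3
        exact ⟨ε, h1, h2, h3.1, h3.2.2⟩
      have h2 : ∀ v, v ∈ B → ∃ ε, δ = β ++ ε ∧ g • hd U ε (k⁻¹ • v) ∈ A := by
        intro v hv
        obtain ⟨ε, h1, h2, h3⟩ := (h _ _).2 (rel_base ht (v := k⁻¹ • v) (by simpa using hv))
        exact ⟨ε, h1, h2⟩
      obtain ⟨ε, e1, -, e2, e3⟩ := h1 v hv
      obtain ⟨ε', e1', -⟩ := h2 w hw
      have hε : ε = [] := by
        have : β.length = β.length + ε'.length + ε.length := by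
          conv_lhs => rw [e1, e1']
          simp [add_assoc]
        exact List.eq_nil_of_length_eq_zero (by omega)
      subst hε
      simp only [List.append_nil, act_nil, coc_nil] at e1 e2 e3
      subst e1 e2 e3
      have hAB : A = B := by
        ext u
        constructor
        · intro hu
          obtain ⟨ε, e1, e2, -⟩ := h1 u hu
          obtain rfl : ε = [] := by simpa using e1
          simpa [hd] using e2
        · intro hu
          obtain ⟨ε, e1, e2⟩ := h2 u hu
          obtain rfl : ε = [] := by simpa using e1
          simpa [hd] using e2
      subst hAB
      rfl

lemma mul_ext_right {α β δ ε : List E} {A B : Set V} {g h : G}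
    (s : U.Valid α A g β) (t : U.Valid (β ++ ε) B h δ)
    (hc : ε ≠ [] ∧ g • U.pathRng ε ⊆ A) :
    elt α A g β s * elt (β ++ ε) B h δ t = elt _ _ _ _ (s.ext_right t ⟨rfl, hc⟩) := by
  change mul _ _ = _
  simp only [mul]
  rw [dif_pos (by simpa using hc)]
  simp only [List.drop_left]

lemma mul_ext_left {α γ δ ε : List E} {A B : Set V} {g h : G}
    (s : U.Valid α A g (γ ++ ε)) (t : U.Valid γ B h δ)
    (hc : ε ≠ [] ∧ U.pathRng ε ⊆ B) :
    elt α A g (γ ++ ε) s * elt γ B h δ t = elt _ _ _ _ (s.ext_left t ⟨rfl, hc⟩) := by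
  change mul _ _ = _
  simp only [mul]
  rw [dif_neg (by simp [hc.1]), dif_pos (by simpa using hc)]
  simp only [List.drop_left]

lemma mul_ext_same {α β δ : List E} {A B : Set V} {g h : G}
    (s : U.Valid α A g β) (t : U.Valid β B h δ) (hc : (A ∩ g • B).Nonempty) :
    elt α A g β s * elt β B h δ t = elt _ _ _ _ (s.ext_same t ⟨rfl, hc⟩) := by
  change mul _ _ = _
  simp only [mul]
  rw [dif_neg (by simp), dif_neg (by simp), dif_pos (by simpa using hc)]

lemma mul_eq_zero {α β γ δ : List E} {A B : Set V} {g h : G}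
    (s : U.Valid α A g β) (t : U.Valid γ B h δ)
    (h1 : ∀ ε, γ = β ++ ε → ε ≠ [] → ¬ g • U.pathRng ε ⊆ A)
    (h2 : ∀ ε, β = γ ++ ε → ε ≠ [] → ¬ U.pathRng ε ⊆ B)
    (h3 : γ = β → ¬ (A ∩ g • B).Nonempty) :
    elt α A g β s * elt γ B h δ t = zero := by
  change mul _ _ = _
  simp only [mul]
  rw [dif_neg (fun h => h1 _ h.1 h.2.1 h.2.2), dif_neg (fun h => h2 _ h.1 h.2.1 h.2.2),
    dif_neg (fun h => h3 h.1 h.2)]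

lemma rel_mul_aux {α β γ δ : List E} {A B : Set V} {g h : G}
    (s : U.Valid α A g β) (t : U.Valid γ B h δ) (x z : List E × V × G) :
    (∃ y, (elt γ B h δ t).Rel x y ∧ (elt α A g β s).Rel y z) ↔
      ∃ ε ε', x.1 = δ ++ ε ∧ h • hd U ε x.2.1 ∈ B ∧ γ ++ U.act h ε = β ++ ε' ∧
        g • hd U ε' (U.coc h ε • x.2.1) ∈ A ∧
        z = (α ++ U.act g ε', U.coc g ε' • U.coc h ε • x.2.1, U.coc g ε' * (U.coc h ε * x.2.2)) := by
  constructor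
  · rintro ⟨y, ⟨ε, h1, h2, rfl⟩, ε', h3, h4, h5⟩
    exact ⟨ε, ε', h1, h2, h3, h4, h5⟩
  · rintro ⟨ε, ε', h1, h2, h3, h4, h5⟩
    exact ⟨_, ⟨ε, h1, h2, rfl⟩, ε', h3, h4, h5⟩

lemma rel_mul (s t : Semi U) (x z : List E × V × G) :
    (s * t).Rel x z ↔ ∃ y, t.Rel x y ∧ s.Rel y z := by
  cases s with
  | zero =>
    constructor
    · exact False.elim
    · rintro ⟨y, -, h⟩
      exact h.elim
  | elt α A g β s =>
  cases t with
  | zero =>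
    constructor
    · exact False.elim
    · rintro ⟨y, h, -⟩
      exact h.elim
  | elt γ B h δ t =>
  obtain ⟨p, v, k⟩ := x
  rw [rel_mul_aux]
  by_cases c1 : ∃ ε, γ = β ++ ε ∧ ε ≠ []
  · obtain ⟨η, rfl, hη⟩ := c1
    by_cases c2 : g • U.pathRng η ⊆ A
    · rw [mul_ext_right s t ⟨hη, c2⟩]
      have hB : U.coc g η • B ⊆ U.pathSrc (U.act g η) := by
        rw [pathSrc_act]
        have := t.subset.trans Set.inter_subset_left
        rw [Ultragraph.pathSrc_append _ _ hη] at this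
        exact Set.smul_set_mono this
      simp only [Rel, Set.inter_eq_right.2 hB, mul_smul, Set.smul_mem_smul_set_iff]
      refine exists_congr fun ε => ?_
      simp only [List.append_assoc, List.append_cancel_left_eq, act_mul, coc_mul, mul_smul]
      constructor
      · rintro ⟨h1, h2, rfl⟩
        refine ⟨_, h1, h2, rfl, ?_, ?_⟩
        · rw [hd_append _ _ _ hη v]
          exact (smul_pathRng_subset hη v g A).1 c2
        · simp [act_append, coc_append, mul_assoc]
      · rintro ⟨ε', h1, h2, rfl, h4, rfl⟩
        refine ⟨h1, h2, ?_⟩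
        simp [act_append, coc_append, mul_assoc]
    · rw [mul_eq_zero s t]
      · simp only [Rel, false_iff, not_exists]
        rintro ε ε' ⟨h1, h2, h3, h4, h5⟩
        rw [List.append_assoc, List.append_cancel_left_eq] at h3
        subst h3
        rw [hd_append _ _ _ hη v] at h4
        exact c2 ((smul_pathRng_subset hη v g A).2 h4)
      · intro ε h1 _
        rw [List.append_cancel_left_eq] at h1
        exact h1 ▸ c2
      · intro ε h1 h2
        simp [hη] at h1
      · intro h1
        simp [hη] at h1
  by_cases c1' : ∃ ε, β = γ ++ ε ∧ ε ≠ []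
  · obtain ⟨η, rfl, hη⟩ := c1'
    by_cases c2 : U.pathRng η ⊆ B
    · rw [mul_ext_left s t ⟨hη, c2⟩]
      simp only [Rel, Set.inter_eq_left.2 (s.subset_ext h ⟨rfl, hη⟩)]
      have key : ∀ ε' : List E, U.act h (U.act h⁻¹ η ++ ε') =
          η ++ U.act (U.coc h⁻¹ η)⁻¹ ε' := by
        intro ε'
        rw [act_append, act_act_inv, coc_act_inv]
      constructor
      · rintro ⟨ε, h1, h2, rfl⟩
        refine ⟨U.act h⁻¹ η ++ ε, U.act (U.coc h⁻¹ η)⁻¹ ε, by simpa using h1, ?_, ?_, ?_, ?_⟩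
        · rw [hd_append _ _ _ (U.act_ne_nil hη) (U.coc h⁻¹ η • v), hd_act, smul_inv_smul]
          exact (pathRng_subset hη v B).1 c2
        · rw [key, List.append_assoc]
        · rw [coc_append, coc_act_inv, hd_act, ← mul_smul]
          exact h2
        · simp [act_mul, coc_mul, coc_append, coc_act_inv, mul_smul, mul_assoc]
      · rintro ⟨ε, ε', h1, h2, h3, h4, rfl⟩
        rw [List.append_assoc, List.append_cancel_left_eq] at h3
        have h3' : ε = U.act h⁻¹ η ++ U.act (U.coc h⁻¹ η) ε' := by
          rw [← act_append, ← h3, act_inv_act]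
        have h3'' : ε' = U.act (U.coc h⁻¹ η)⁻¹ (U.act (U.coc h⁻¹ η) ε') := by
          rw [act_inv_act]
        generalize U.act (U.coc h⁻¹ η) ε' = μ at h3' h3''
        subst h3' h3''
        refine ⟨μ, by simpa using h1, ?_, ?_⟩
        · rw [coc_append, coc_act_inv, hd_act, ← mul_smul] at h4
          exact h4
        · simp [act_mul, coc_mul, coc_append, coc_act_inv, mul_smul, mul_assoc]
    · rw [mul_eq_zero s t]
      · simp only [Rel, false_iff, not_exists]
        rintro ε ε' ⟨h1, h2, h3, h4, h5⟩
        rw [List.append_assoc, List.append_cancel_left_eq] at h3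
        rw [← hd_act, h3, hd_append _ _ _ hη v] at h2
        exact c2 ((pathRng_subset hη v B).2 h2)
      · intro ε h1 h2
        simp [hη] at h1
      · intro ε h1 _
        rw [List.append_cancel_left_eq] at h1
        exact h1 ▸ c2
      · intro h1
        simp [hη] at h1
  by_cases c3 : γ = β
  · subst c3
    have key : ∀ ε : List E, (h • hd U ε v ∈ B ∧ g • hd U (U.act h ε) (U.coc h ε • v) ∈ A) ↔
        (g * h) • hd U ε v ∈ A ∩ g • B := by
      intro ε
      rw [hd_act, Set.mem_inter_iff, mul_smul, Set.smul_mem_smul_set_iff, and_comm]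
    by_cases c2 : (A ∩ g • B).Nonempty
    · rw [mul_ext_same s t c2]
      simp only [Rel]
      refine exists_congr fun ε => ?_
      rw [← key]
      simp only [List.append_cancel_left_eq]
      constructor
      · rintro ⟨h1, ⟨h2, h3⟩, rfl⟩
        exact ⟨_, h1, h2, rfl, h3, by simp [act_mul, coc_mul, mul_smul, mul_assoc]⟩
      · rintro ⟨ε', h1, h2, rfl, h3, rfl⟩
        exact ⟨h1, ⟨h2, h3⟩, by simp [act_mul, coc_mul, mul_smul, mul_assoc]⟩
    · rw [mul_eq_zero s t]
      · simp only [Rel, false_iff, not_exists]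
        rintro ε ε' ⟨h1, h2, h3, h4, h5⟩
        rw [List.append_cancel_left_eq] at h3
        subst h3
        exact c2 ⟨_, (key ε).1 ⟨h2, h4⟩⟩
      · intro ε h1 h2
        exact absurd (by simpa using h1) h2
      · intro ε h1 h2
        exact absurd (by simpa using h1) h2
      · exact fun _ => c2
  · rw [mul_eq_zero s t]
    · simp only [Rel, false_iff, not_exists]
      rintro ε ε' ⟨h1, h2, h3, h4, h5⟩
      rcases List.append_eq_append_iff.1 h3 with ⟨a, ha, -⟩ | ⟨a, ha, -⟩
      · by_cases h0 : a = []
        · subst h0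
          exact c3 (by simpa using ha.symm)
        · exact c1' ⟨a, ha, h0⟩
      · by_cases h0 : a = []
        · subst h0
          exact c3 (by simpa using ha)
        · exact c1 ⟨a, ha, h0⟩
    · exact fun ε h1 h2 _ => c1 ⟨ε, h1, h2⟩
    · exact fun ε h1 h2 _ => c1' ⟨ε, h1, h2⟩
    · exact fun h1 => absurd h1 c3

noncomputable instance : InverseSemigroupWithZero (Semi U) where
  mul_assoc a b c := rel_ext fun x z => by
    simp only [rel_mul]
    constructor
    · rintro ⟨y, h1, w, h2, h3⟩
      exact ⟨w, ⟨y, h1, h2⟩, h3⟩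
    · rintro ⟨w, ⟨y, h1, h2⟩, h3⟩
      exact ⟨y, h1, w, h2, h3⟩
  zero_mul a := rfl
  mul_zero a := by cases a <;> rfl
  mul_star_mul s := rel_ext fun x z => by
    simp only [rel_mul, rel_star]
    constructor
    · rintro ⟨y, h1, w, h2, h3⟩
      rwa [rel_inj h1 h2]
    · intro h
      exact ⟨z, h, x, h, h⟩
  star_mul_star s := rel_ext fun x z => by
    simp only [rel_mul, rel_star]
    constructor
    · rintro ⟨y, h1, w, h2, h3⟩
      rwa [rel_fun h1 h2]
    · intro h
      exact ⟨z, h, x, h, h⟩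
  star_unique s t hs ht := rel_ext fun x y => by
    rw [rel_star]
    constructor
    · intro h
      have h' := h
      rw [← ht, rel_mul] at h'
      obtain ⟨a, h1, h2⟩ := h'
      obtain ⟨b, h2, h3⟩ := (rel_mul _ _ _ _).1 h2
      rwa [rel_fun h1 h, rel_inj h3 h] at h2
    · intro h
      have h' := h
      rw [← hs, rel_mul] at h'
      obtain ⟨a, h1, h2⟩ := h'
      obtain ⟨b, h2, h3⟩ := (rel_mul _ _ _ _).1 h2
      rwa [rel_fun h1 h, rel_inj h3 h] at h2

end Semi

end SelfSimilarUltragraph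

/-! A tight filter `F` with `s* s ∈ F` is trivially fixed by `s` when it contains an idempotent
`e ≤ s`, that is, when the germs of `s` and of `s* s` at `F` coincide. So the tight groupoid is
Hausdorff iff the open set of filters trivially fixed by `s` is closed for every `s`. Since the
filters containing `s* s` form a compact set, and ultrafilters are dense among the tight filters,
this happens iff finitely many idempotents below `s` cover all of them (Exel–Pardo).

For `s = (α, A, g, β)` not idempotent, the nonzero idempotents below `s` are the
`(αε, C, 1, αε)` with `ε ∈ A SF_g`, and there are none unless `α = β`. Two such idempotents meet
only if their paths are comparable, so the minimal elements of `A SF_g` give a cover, and every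
cover needs a separate member for each of them. -/

namespace InverseSemigroupWithZero

variable {S : Type*} [InverseSemigroupWithZero S] {s t e f : S}

lemma isIdempotentElem_star_mul (s : S) : IsIdempotentElem (star s * s) := by
  rw [IsIdempotentElem, ← mul_assoc, star_mul_star]

lemma isIdempotentElem_mul_star (s : S) : IsIdempotentElem (s * star s) := by
  rw [IsIdempotentElem, ← mul_assoc, mul_star_mul]

instance : StarMul S where
  star_involutive s := (star_unique _ _ (star_mul_star s) (mul_star_mul s)).symm
  star_mul s t := by
    have hcomm := idem_comm (isIdempotentElem_mul_star t) (isIdempotentElem_star_mul s)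
    refine (star_unique _ _ ?_ ?_).symm
    · calc s * t * (star t * star s) * (s * t)
          = s * (t * star t * (star s * s)) * t := by simp only [mul_assoc]
        _ = s * star s * s * (t * star t * t) := by rw [hcomm]; simp only [mul_assoc]
        _ = s * t := by rw [mul_star_mul, mul_star_mul]
    · calc star t * star s * (s * t) * (star t * star s)
          = star t * (star s * s * (t * star t)) * star s := by simp only [mul_assoc]
        _ = star t * t * star t * (star s * s * star s) := by
            rw [← hcomm]; simp only [mul_assoc]
        _ = star t * star s := by rw [star_mul_star, star_mul_star]

/-- The set of idempotents below `s` in the natural partial order, written `J_s` by Exel and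
Pardo. -/
def idempotentsBelow (s : S) : Set S := {e | IsIdempotentElem e ∧ NatLE e s}

/-- Exel's notion of a cover `T` of a set `X` of idempotents: a subset of `X` such that each
nonzero member of `X` has nonzero product with a member of `T`. -/
def IsCover (T X : Set S) : Prop := T ⊆ X ∧ ∀ e ∈ X, e ≠ 0 → ∃ f ∈ T, e * f ≠ 0

lemma mem_idempotentsBelow : e ∈ idempotentsBelow s ↔ IsIdempotentElem e ∧ s * e = e := by
  refine and_congr_right fun he => ⟨?_, fun h => ⟨e, he, h.symm⟩⟩
  rintro ⟨f, hf, rfl⟩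
  calc s * (s * f) = s * (s * f * f) := by rw [mul_assoc s f, hf.eq]
    _ = s * f * (s * f) := by rw [← idem_comm hf he, mul_assoc]
    _ = s * f := he.eq

lemma mul_eq_left_of_mem_idempotentsBelow (he : e ∈ idempotentsBelow s) : e * s = e := by
  obtain ⟨he, hse⟩ := mem_idempotentsBelow.1 he
  have hes : e * star s = e := by
    simpa only [star_mul, star_eq_self he] using congrArg star hse
  calc e * s = s * e * star s * s := by rw [hse, hes]
    _ = s * (e * (star s * s)) := by simp only [mul_assoc]
    _ = s * star s * s * e := by
        rw [idem_comm he (isIdempotentElem_star_mul s)]; simp only [mul_assoc]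
    _ = e := by rw [mul_star_mul, hse]

lemma mem_idempotentsBelow_star (he : e ∈ idempotentsBelow s) : e ∈ idempotentsBelow (star s) := by
  refine mem_idempotentsBelow.2 ⟨he.1, ?_⟩
  simpa only [star_mul, star_eq_self he.1] using
    congrArg star (mul_eq_left_of_mem_idempotentsBelow he)

lemma star_mul_self_mul_of_mem_idempotentsBelow (he : e ∈ idempotentsBelow s) :
    star s * s * e = e := by
  rw [mul_assoc, (mem_idempotentsBelow.1 he).2,
    (mem_idempotentsBelow.1 (mem_idempotentsBelow_star he)).2]

lemma mul_mem_idempotentsBelow (he : e ∈ idempotentsBelow s) (hf : IsIdempotentElem f) :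
    e * f ∈ idempotentsBelow s :=
  mem_idempotentsBelow.2
    ⟨isIdempotentElem_mul he.1 hf, by rw [← mul_assoc, (mem_idempotentsBelow.1 he).2]⟩

lemma mul_eq_mul_of_mem_idempotentsBelow (he : e ∈ idempotentsBelow (star s * t)) :
    s * e = t * e := by
  have hst : star s * t * e = e := (mem_idempotentsBelow.1 he).2
  have hts : star t * s * e = e := by
    simpa only [star_mul, star_star] using
      (mem_idempotentsBelow.1 (mem_idempotentsBelow_star he)).2
  calc s * e = s * star s * (t * star t * t) * e := by
        rw [mul_star_mul]; nth_rw 1 [← hst]; simp only [mul_assoc]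
    _ = t * star t * (s * star s * t * e) := by
        rw [← mul_assoc (s * star s), idem_comm (isIdempotentElem_mul_star s)
          (isIdempotentElem_mul_star t)]
        simp only [mul_assoc]
    _ = t * (star t * s * (star s * t * e)) := by simp only [mul_assoc]
    _ = t * e := by rw [hst, hts]

lemma star_mul_self_mul_mem_idempotentsBelow (he : IsIdempotentElem e) (h : s * e = t * e) :
    star s * s * e ∈ idempotentsBelow (star s * t) := by
  have hs := isIdempotentElem_star_mul s
  refine mem_idempotentsBelow.2 ⟨isIdempotentElem_mul hs he, ?_⟩
  calc star s * t * (star s * s * e) = star s * (t * e) * (star s * s) := by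
        rw [idem_comm hs he]; simp only [mul_assoc]
    _ = star s * s * (e * (star s * s)) := by rw [← h]; simp only [mul_assoc]
    _ = star s * s * e := by rw [idem_comm he hs, ← mul_assoc, hs.eq]

lemma isCover_singleton_idempotentsBelow (hs : IsIdempotentElem s) :
    IsCover {s} (idempotentsBelow s) := by
  refine ⟨Set.singleton_subset_iff.2 (mem_idempotentsBelow.2 ⟨hs, hs.eq⟩), fun e he h0 => ?_⟩
  exact ⟨s, rfl, by rwa [mul_eq_left_of_mem_idempotentsBelow he]⟩

lemma IsFilter.mem_of_mul_eq {F : Set S} (hF : IsFilter F) (he : e ∈ F)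
    (hf : IsIdempotentElem f) (h : f * e = e) : f ∈ F :=
  hF.up_mem e he f hf ⟨e, hF.idem e he, h.symm⟩

lemma isFilter_setOf_exists_mul_eq {B : Set S} (hB : B.Nonempty)
    (hidem : ∀ b ∈ B, IsIdempotentElem b) (hmul : ∀ b ∈ B, ∀ c ∈ B, b * c ∈ B) :
    IsFilter {f | IsIdempotentElem f ∧ ∃ b ∈ B, f * b = b} where
  nonempty := hB.mono fun b hb => ⟨hidem b hb, b, hb, hidem b hb⟩
  idem _ hf := hf.1
  mul_mem := by
    rintro f ⟨hf, b, hb, hfb⟩ k ⟨hk, c, hc, hkc⟩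
    refine ⟨isIdempotentElem_mul hf hk, b * c, hmul b hb c hc, ?_⟩
    calc f * k * (b * c) = f * (k * c) * b := by
          rw [idem_comm (hidem b hb) (hidem c hc)]; simp only [mul_assoc]
      _ = f * b * c := by rw [hkc, mul_assoc, mul_assoc, idem_comm (hidem c hc) (hidem b hb)]
      _ = b * c := by rw [hfb]
  up_mem := by
    rintro f ⟨hf, b, hb, hfb⟩ k hk hfk
    have hkf : k * f = f := (mem_idempotentsBelow.1 ⟨hf, hfk⟩).2
    exact ⟨hk, b, hb, by rw [← hfb, ← mul_assoc, hkf]⟩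

lemma isFilter_sUnion {c : Set (Set S)} (hc : ∀ F ∈ c, IsFilter F) (hchain : IsChain (· ⊆ ·) c)
    (hne : c.Nonempty) : IsFilter (⋃₀ c) where
  nonempty := by
    obtain ⟨F, hF⟩ := hne
    exact (hc F hF).nonempty.mono (Set.subset_sUnion_of_mem hF)
  idem := fun f ⟨F, hF, hf⟩ => (hc F hF).idem f hf
  mul_mem := by
    rintro f ⟨F, hF, hf⟩ k ⟨K, hK, hk⟩
    rcases hchain.total hF hK with h | h
    · exact ⟨K, hK, (hc K hK).mul_mem f (h hf) k hk⟩
    · exact ⟨F, hF, (hc F hF).mul_mem f hf k (h hk)⟩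
  up_mem := fun f ⟨F, hF, hf⟩ k hk hle => ⟨F, hF, (hc F hF).up_mem f hf k hk hle⟩

lemma exists_mem_ultrafilters_of_subset (F : FilterSpace S) : ∃ K ∈ ultrafilters S, F.1 ⊆ K.1 := by
  obtain ⟨M, hFM, hM⟩ := zorn_subset_nonempty {F : Set S | IsFilter F ∧ (0 : S) ∉ F}
    (fun c hc hchain hne => ⟨⋃₀ c, ⟨isFilter_sUnion (fun F hF => (hc hF).1) hchain hne,
      fun ⟨F, hF, h0⟩ => (hc hF).2 h0⟩, fun F hF => Set.subset_sUnion_of_mem hF⟩) F.1 F.2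
  exact ⟨⟨M, hM.prop⟩, fun K h => (hM.eq_of_subset K.2 h).symm, hFM⟩

lemma exists_mem_ultrafilters (he : IsIdempotentElem e) (h0 : e ≠ 0) :
    ∃ K ∈ ultrafilters S, e ∈ K.1 := by
  have hF : IsFilter {f | IsIdempotentElem f ∧ ∃ b ∈ ({e} : Set S), f * b = b} :=
    isFilter_setOf_exists_mul_eq (Set.singleton_nonempty e) (by simpa using he)
      (by simpa using he.eq)
  obtain ⟨K, hK, hFK⟩ := exists_mem_ultrafilters_of_subset
    ⟨_, hF, by simpa [eq_comm] using fun _ => h0⟩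
  exact ⟨K, hK, hFK ⟨he, e, rfl, he⟩⟩

lemma exists_mul_eq_zero_of_notMem {K : FilterSpace S} (hK : K ∈ ultrafilters S)
    (hf : IsIdempotentElem f) (hfK : f ∉ K.1) : ∃ k ∈ K.1, k * f = 0 := by
  by_contra! hne
  have hidem := K.2.1.idem
  let F : FilterSpace S := ⟨{h | IsIdempotentElem h ∧ ∃ b ∈ (· * f) '' K.1, h * b = b},
    isFilter_setOf_exists_mul_eq (K.2.1.nonempty.image _)
      (by rintro _ ⟨k, hk, rfl⟩; exact isIdempotentElem_mul (hidem k hk) hf)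
      (by
        rintro _ ⟨k, hk, rfl⟩ _ ⟨l, hl, rfl⟩
        refine ⟨k * l, K.2.1.mul_mem k hk l hl, ?_⟩
        calc k * l * f = k * (l * (f * f)) := by rw [hf.eq, mul_assoc]
          _ = k * f * (l * f) := by
              rw [mul_assoc k, ← mul_assoc f, idem_comm hf (hidem l hl), mul_assoc l]),
    by rintro ⟨-, _, ⟨k, hk, rfl⟩, h⟩; exact hne k hk (h.symm.trans (zero_mul _))⟩
  have hKF : K.1 ⊆ F.1 := fun k hk =>
    ⟨hidem k hk, k * f, ⟨k, hk, rfl⟩, by rw [← mul_assoc, (hidem k hk).eq]⟩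
  have hfF : f ∈ F.1 := by
    obtain ⟨k, hk⟩ := K.2.1.nonempty
    exact ⟨hf, k * f, ⟨k, hk, rfl⟩, by rw [idem_comm (hidem k hk) hf, ← mul_assoc, hf.eq]⟩
  exact hfK (hK F hKF ▸ hfF)

lemma exists_forall_mul_eq_zero {K : FilterSpace S} (hK : K ∈ ultrafilters S) {T : Set S}
    (hT : T.Finite) (hidem : ∀ f ∈ T, IsIdempotentElem f) (hTK : ∀ f ∈ T, f ∉ K.1) :
    ∃ k ∈ K.1, ∀ f ∈ T, k * f = 0 := by
  induction T, hT using Set.Finite.induction_on with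
  | empty => exact K.2.1.nonempty.imp fun k hk => ⟨hk, by simp⟩
  | @insert f T _ _ ih =>
    simp only [Set.forall_mem_insert] at hidem hTK ⊢
    obtain ⟨k, hk, hkf⟩ := exists_mul_eq_zero_of_notMem hK hidem.1 hTK.1
    obtain ⟨l, hl, hlT⟩ := ih hidem.2 hTK.2
    refine ⟨k * l, K.2.1.mul_mem k hk l hl, ?_, fun f' hf' => ?_⟩
    · rw [idem_comm (K.2.1.idem k hk) (K.2.1.idem l hl), mul_assoc, hkf, mul_zero]
    · rw [mul_assoc, hlT f' hf', mul_zero]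

namespace FilterSpace

lemma isOpen_basicNhd {T : Finset S} (he : IsIdempotentElem e)
    (hT : ∀ f ∈ T, IsIdempotentElem f) : IsOpen (basicNhd e T) :=
  TopologicalSpace.isOpen_generateFrom_of_mem ⟨e, T, he, hT, rfl⟩

lemma isClopen_setOf_mem (e : S) : IsClopen {F : FilterSpace S | e ∈ F.1} := by
  by_cases he : IsIdempotentElem e
  · have hopen : {F : FilterSpace S | e ∈ F.1} = basicNhd e ∅ := by ext F; simp [basicNhd]
    have hcompl : {F : FilterSpace S | e ∈ F.1}ᶜ =
        ⋃ (f : S) (_ : IsIdempotentElem f), basicNhd f {e} := by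
      ext F
      simp only [basicNhd, Set.mem_compl_iff, Set.mem_ofPred_eq, Set.mem_iUnion,
        Finset.mem_singleton, forall_eq]
      refine ⟨fun h => ?_, fun ⟨_, _, _, h⟩ => h⟩
      obtain ⟨f, hf⟩ := F.2.1.nonempty
      exact ⟨f, F.2.1.idem f hf, hf, h⟩
    refine ⟨isOpen_compl_iff.1 ?_, hopen ▸ isOpen_basicNhd he (by simp)⟩
    exact hcompl ▸ isOpen_biUnion fun f hf => isOpen_basicNhd hf (by simpa using he)
  · have hempty : {F : FilterSpace S | e ∈ F.1} = ∅ :=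
      Set.eq_empty_of_forall_notMem fun F hF => he (F.2.1.idem e hF)
    exact hempty ▸ isClopen_empty

instance : T2Space (FilterSpace S) := by
  refine T2Space.of_injective_continuous
    (f := fun (F : FilterSpace S) (e : S) => {F : FilterSpace S | e ∈ F.1}.boolIndicator F)
    (fun F F' h => Subtype.ext (Set.ext fun e => ?_))
    (continuous_pi fun e => (continuous_boolIndicator_iff_isClopen _).2 (isClopen_setOf_mem e))
  have he : {F : FilterSpace S | e ∈ F.1}.boolIndicator F =
      {F : FilterSpace S | e ∈ F.1}.boolIndicator F' := congrFun h e
  change F ∈ {F : FilterSpace S | e ∈ F.1} ↔ F' ∈ {F : FilterSpace S | e ∈ F.1}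
  rw [Set.mem_iff_boolIndicator, Set.mem_iff_boolIndicator, he]

lemma isFilter_setOf_eventually_mem {l : Filter (FilterSpace S)} [l.NeBot]
    (he : ∀ᶠ F in l, e ∈ F.1) : IsFilter {f | ∀ᶠ F in l, f ∈ F.1} where
  nonempty := ⟨e, he⟩
  idem f hf := by
    obtain ⟨F, hF⟩ := Filter.Eventually.exists hf
    exact F.2.1.idem f hF
  mul_mem f hf k hk := by
    filter_upwards [hf, hk] with F hF hF' using F.2.1.mul_mem f hF k hF'
  up_mem f hf k hk hle := by
    filter_upwards [hf] with F hF using F.2.1.up_mem f hF k hk hle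

lemma isCompact_setOf_mem (e : S) : IsCompact {F : FilterSpace S | e ∈ F.1} := by
  refine isCompact_iff_ultrafilter_le_nhds.2 fun 𝒰 h𝒰 => ?_
  have he : ∀ᶠ F in (𝒰 : Filter (FilterSpace S)), e ∈ F.1 := Filter.le_principal_iff.1 h𝒰
  let L : FilterSpace S := ⟨_, isFilter_setOf_eventually_mem he, fun h0 => by
    obtain ⟨F, hF⟩ := Filter.Eventually.exists h0
    exact F.2.2 hF⟩
  refine ⟨L, he, Filter.tendsto_id'.1 (TopologicalSpace.tendsto_nhds_generateFrom_iff.2 ?_)⟩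
  rintro _ ⟨f, T, -, -, rfl⟩ ⟨hf, hT⟩
  exact Filter.Eventually.and hf
    ((Filter.eventually_all_finset T).2 fun k hk => Ultrafilter.eventually_not.2 (hT k hk))

end FilterSpace

namespace TightSpectrum

instance : T2Space (TightSpectrum S) :=
  inferInstanceAs (T2Space {F : FilterSpace S // F ∈ closure (ultrafilters S)})

lemma isFilter (F : TightSpectrum S) : IsFilter F.carrier := F.1.2.1

lemma zero_notMem (F : TightSpectrum S) : (0 : S) ∉ F.carrier := F.1.2.2

/-- The set of tight filters containing `e`, written `D_e` by Exel; for `e = s* s` it is the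
domain of the partial action of `s` on the tight spectrum. -/
def domain (e : S) : Set (TightSpectrum S) := {F | e ∈ F.carrier}

lemma isClopen_domain (e : S) : IsClopen (domain e) :=
  (FilterSpace.isClopen_setOf_mem e).preimage continuous_subtype_val

lemma isCompact_domain (e : S) : IsCompact (domain e) :=
  (isClosed_closure (s := ultrafilters S)).isClosedEmbedding_subtypeVal.isCompact_preimage
    (FilterSpace.isCompact_setOf_mem e)

/-- The set of tight filters trivially fixed by `s` in the sense of Exel and Pardo: those
containing an idempotent below `s`. -/
def triviallyFixed (s : S) : Set (TightSpectrum S) := ⋃ e ∈ idempotentsBelow s, domain e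

lemma mem_triviallyFixed {F : TightSpectrum S} :
    F ∈ triviallyFixed s ↔ ∃ e ∈ idempotentsBelow s, e ∈ F.carrier := by
  simp [triviallyFixed, domain]

lemma triviallyFixed_subset_domain (s : S) : triviallyFixed s ⊆ domain (star s * s) := by
  intro F hF
  obtain ⟨e, he, heF⟩ := mem_triviallyFixed.1 hF
  exact F.isFilter.mem_of_mul_eq heF (isIdempotentElem_star_mul s)
    (star_mul_self_mul_of_mem_idempotentsBelow he)

lemma mem_triviallyFixed_star_mul {F : TightSpectrum S} (hs : star s * s ∈ F.carrier) :
    F ∈ triviallyFixed (star s * t) ↔ ∃ e ∈ F.carrier, s * e = t * e := by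
  rw [mem_triviallyFixed]
  constructor
  · rintro ⟨e, he, heF⟩
    exact ⟨e, heF, mul_eq_mul_of_mem_idempotentsBelow he⟩
  · rintro ⟨e, heF, hst⟩
    exact ⟨_, star_mul_self_mul_mem_idempotentsBelow (F.isFilter.idem e heF) hst,
      F.isFilter.mul_mem _ hs e heF⟩

lemma mem_triviallyFixed_iff_mul_eq {F : TightSpectrum S} (hs : star s * s ∈ F.carrier) :
    F ∈ triviallyFixed s ↔ ∃ e ∈ F.carrier, s * e = star s * s * e := by
  rw [mem_triviallyFixed]
  constructor
  · rintro ⟨e, he, heF⟩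
    exact ⟨e, heF, by
      rw [(mem_idempotentsBelow.1 he).2, star_mul_self_mul_of_mem_idempotentsBelow he]⟩
  · rintro ⟨e, heF, hse⟩
    refine ⟨_, mem_idempotentsBelow.2 ⟨?_, ?_⟩, F.isFilter.mul_mem _ hs e heF⟩
    · exact isIdempotentElem_mul (isIdempotentElem_star_mul s) (F.isFilter.idem e heF)
    · rw [← mul_assoc, ← mul_assoc, mul_star_mul, hse]

lemma exists_mem_of_forall_mul_ne_zero (F : TightSpectrum S) {T : Set S} (hT : T.Finite)
    (hidem : ∀ f ∈ T, IsIdempotentElem f) (heF : e ∈ F.carrier)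
    (hcover : ∀ k, IsIdempotentElem k → e * k ≠ 0 → ∃ f ∈ T, e * k * f ≠ 0) :
    ∃ f ∈ T, f ∈ F.carrier := by
  by_contra! hTF
  lift T to Finset S using hT
  obtain ⟨K, ⟨heK, hTK⟩, hK⟩ := mem_closure_iff.1 F.2 (basicNhd e T)
    (FilterSpace.isOpen_basicNhd (F.isFilter.idem e heF) hidem) ⟨heF, hTF⟩
  obtain ⟨k, hk, hkT⟩ := exists_forall_mul_eq_zero hK T.finite_toSet hidem hTK
  have hek : e * k ≠ 0 := ne_of_mem_of_not_mem (K.2.1.mul_mem e heK k hk) K.2.2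
  obtain ⟨f, hf, hne⟩ := hcover k (K.2.1.idem k hk) hek
  exact hne (by rw [mul_assoc, hkT f hf, mul_zero])

theorem isClosed_triviallyFixed_iff (s : S) :
    IsClosed (triviallyFixed s) ↔ ∃ T : Set S, T.Finite ∧ IsCover T (idempotentsBelow s) := by
  constructor
  · intro hclosed
    have hcompact : IsCompact (triviallyFixed s) :=
      (isCompact_domain _).of_isClosed_subset hclosed (triviallyFixed_subset_domain s)
    obtain ⟨T, hTs, hT, hsub⟩ := hcompact.elim_finite_subcover_image
      (fun e _ => (isClopen_domain e).isOpen) subset_rfl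
    refine ⟨T, hT, hTs, fun e he h0 => ?_⟩
    obtain ⟨K, hK, heK⟩ := exists_mem_ultrafilters he.1 h0
    let F : TightSpectrum S := ⟨K, subset_closure hK⟩
    have hF : F ∈ triviallyFixed s := mem_triviallyFixed.2 ⟨e, he, heK⟩
    obtain ⟨f, hf, hfF⟩ := Set.mem_iUnion₂.1 (hsub hF)
    exact ⟨f, hf, ne_of_mem_of_not_mem (F.isFilter.mul_mem e heK f hfF) F.zero_notMem⟩
  · rintro ⟨T, hT, hTs, hcover⟩
    have hunion : triviallyFixed s = ⋃ f ∈ T, domain f := by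
      refine subset_antisymm (fun F hF => ?_) (Set.biUnion_subset_biUnion_left hTs)
      obtain ⟨e, he, heF⟩ := mem_triviallyFixed.1 hF
      obtain ⟨f, hf, hfF⟩ := F.exists_mem_of_forall_mul_ne_zero hT (fun f hf => (hTs hf).1) heF
        fun k hk => hcover _ (mul_mem_idempotentsBelow he hk)
      exact Set.mem_biUnion hf hfF
    exact hunion ▸ hT.isClosed_biUnion fun f _ => (isClopen_domain f).isClosed

end TightSpectrum

open TightSpectrum

/-- The germ `[s, F]`. -/
def germ (s : S) (F : TightSpectrum S) (h : star s * s ∈ F.carrier) : TightGroupoid S :=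
  Quotient.mk (germSetoid S) ⟨s, F, h⟩

lemma germ_eq_germ {F : TightSpectrum S} {hs : star s * s ∈ F.carrier}
    {ht : star t * t ∈ F.carrier} :
    germ s F hs = germ t F ht ↔ ∃ e ∈ F.carrier, s * e = t * e :=
  Quotient.eq.trans (and_iff_right rfl)

lemma germ_mem_germSet {F : TightSpectrum S} {hs : star s * s ∈ F.carrier}
    {W : Set (TightSpectrum S)} :
    germ s F hs ∈ germSet t W ↔
      F ∈ W ∧ star t * t ∈ F.carrier ∧ ∃ e ∈ F.carrier, s * e = t * e := by
  constructor
  · rintro ⟨p, rfl, hpW, h⟩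
    obtain ⟨rfl : F = p.filter, he⟩ := Quotient.exact h
    exact ⟨hpW, p.mem, he⟩
  · rintro ⟨hW, ht, he⟩
    exact ⟨⟨t, F, ht⟩, rfl, hW, Quotient.sound ⟨rfl, he⟩⟩

lemma isOpen_germSet (s : S) {W : Set (TightSpectrum S)} (hW : IsOpen W) : IsOpen (germSet s W) :=
  TopologicalSpace.isOpen_generateFrom_of_mem ⟨s, W, hW, rfl⟩

lemma continuous_germ {X : Type*} [TopologicalSpace X] {F : X → TightSpectrum S}
    (hF : Continuous F) (hs : ∀ x, star s * s ∈ (F x).carrier) :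
    Continuous fun x => germ s (F x) (hs x) := by
  refine continuous_generateFrom_iff.2 ?_
  rintro _ ⟨t, W, hW, rfl⟩
  have hpre : (fun x => germ s (F x) (hs x)) ⁻¹' germSet t W =
      F ⁻¹' (W ∩ domain (star t * t) ∩ ⋃ (e : S) (_ : s * e = t * e), domain e) := by
    ext x
    simp only [Set.mem_preimage, germ_mem_germSet, Set.mem_inter_iff, Set.mem_iUnion, domain,
      Set.mem_ofPred_eq, and_assoc, exists_prop, and_comm (a := s * _ = t * _)]
  rw [hpre]
  exact ((hW.inter (isClopen_domain _).isOpen).inter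
    (isOpen_biUnion fun e _ => (isClopen_domain e).isOpen)).preimage hF

lemma isClosed_triviallyFixed [T2Space (TightGroupoid S)] (s : S) :
    IsClosed (triviallyFixed s) := by
  have hmem : ∀ F : domain (star s * s), star (star s * s) * (star s * s) ∈ F.1.carrier := by
    intro F
    rw [star_eq_self (isIdempotentElem_star_mul s), (isIdempotentElem_star_mul s).eq]
    exact F.2
  have heq : IsClosed {F : domain (star s * s) |
      germ s F.1 F.2 = germ (star s * s) F.1 (hmem F)} :=
    isClosed_eq (continuous_germ continuous_subtype_val _)
      (continuous_germ continuous_subtype_val _)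
  have himage : triviallyFixed s = Subtype.val '' {F : domain (star s * s) |
      germ s F.1 F.2 = germ (star s * s) F.1 (hmem F)} := by
    ext F
    constructor
    · intro hF
      have hs := triviallyFixed_subset_domain s hF
      exact ⟨⟨F, hs⟩, germ_eq_germ.2 ((mem_triviallyFixed_iff_mul_eq hs).1 hF), rfl⟩
    · rintro ⟨⟨F, hs⟩, hF, rfl⟩
      exact (mem_triviallyFixed_iff_mul_eq hs).2 (germ_eq_germ.1 hF)
  exact himage ▸ (isClopen_domain _).isClosed.isClosedEmbedding_subtypeVal.isClosedMap _ heq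

lemma disjoint_germSet {W W' : Set (TightSpectrum S)}
    (h : ∀ F ∈ W, F ∈ W' → star s * s ∈ F.carrier → F ∉ triviallyFixed (star s * t)) :
    Disjoint (germSet s W) (germSet t W') := by
  rw [Set.disjoint_left]
  rintro _ ⟨⟨_, F, hs⟩, rfl, hW, rfl⟩ hx
  obtain ⟨hW', -, he⟩ := germ_mem_germSet.1 hx
  exact h F hW hW' hs ((mem_triviallyFixed_star_mul hs).2 he)

lemma t2Space_tightGroupoid (h : ∀ s : S, IsClosed (triviallyFixed s)) :
    T2Space (TightGroupoid S) := by
  refine ⟨fun x y => ?_⟩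
  induction x using Quotient.ind with | _ p
  induction y using Quotient.ind with | _ q
  obtain ⟨s, F, hs⟩ := p
  obtain ⟨t, F', ht⟩ := q
  intro hne
  suffices hsep : ∃ W W', IsOpen W ∧ IsOpen W' ∧ F ∈ W ∧ F' ∈ W' ∧
      Disjoint (germSet s W) (germSet t W') by
    obtain ⟨W, W', hW, hW', hFW, hFW', hdisj⟩ := hsep
    exact ⟨_, _, isOpen_germSet s hW, isOpen_germSet t hW', ⟨⟨s, F, hs⟩, rfl, hFW, rfl⟩,
      ⟨⟨t, F', ht⟩, rfl, hFW', rfl⟩, hdisj⟩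
  by_cases hFF' : F = F'
  · subst hFF'
    have hF : F ∉ triviallyFixed (star s * t) := fun hF =>
      hne (germ_eq_germ.2 ((mem_triviallyFixed_star_mul hs).1 hF))
    exact ⟨_, _, (h (star s * t)).isOpen_compl, (h (star s * t)).isOpen_compl, hF, hF,
      disjoint_germSet fun _ hF' _ _ => hF'⟩
  · obtain ⟨W, W', hW, hW', hFW, hFW', hdisj⟩ := t2_separation hFF'
    exact ⟨W, W', hW, hW', hFW, hFW',
      disjoint_germSet fun K hK hK' => (Set.disjoint_left.1 hdisj hK hK').elim⟩

theorem t2Space_tightGroupoid_iff : T2Space (TightGroupoid S) ↔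
    ∀ s : S, ∃ T : Set S, T.Finite ∧ IsCover T (idempotentsBelow s) := by
  simp only [← isClosed_triviallyFixed_iff]
  exact ⟨fun _ => isClosed_triviallyFixed, t2Space_tightGroupoid⟩

end InverseSemigroupWithZero

namespace Ultragraph

variable {V E : Type*} {U : Ultragraph V E}

lemma pathRng_append {ε : List E} (hε : ε ≠ []) (μ : List E) :
    U.pathRng (ε ++ μ) = U.pathRng ε := by
  obtain ⟨e, l, rfl⟩ := List.exists_cons_of_ne_nil hε
  rfl

lemma pathSrc_nonempty {γ : List E} (hγ : γ ≠ []) : (U.pathSrc γ).Nonempty := by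
  obtain rfl | ⟨m, e, rfl⟩ := γ.eq_nil_or_concat
  · exact absurd rfl hγ
  · rw [List.concat_eq_append, pathSrc_concat]
    exact U.src_nonempty e

lemma pathRng_subset_pathSrc_of_isPath_append {γ ε : List E} (h : U.IsPath (γ ++ ε))
    (hε : ε ≠ []) : U.pathRng ε ⊆ U.pathSrc γ := by
  obtain rfl | ⟨m, e, rfl⟩ := γ.eq_nil_or_concat
  · exact Set.subset_univ _
  · obtain ⟨f, l, rfl⟩ := List.exists_cons_of_ne_nil hε
    rw [List.concat_eq_append, List.append_assoc] at h
    have hef : U.rng f ∈ U.src e := (List.isChain_cons_cons.1 (List.IsChain.right_of_append h)).1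
    simpa only [List.concat_eq_append, pathSrc_concat, pathRng, Set.singleton_subset_iff] using hef

end Ultragraph

namespace SelfSimilarUltragraph

open scoped Pointwise
open InverseSemigroupWithZero

section MinimalPaths

variable {E : Type*} {X : Set (List E)} {γ ε μ : List E}

lemma exists_minimalPaths_prefix (hε : ε ∈ X) : ∃ μ ∈ minimalPaths X, μ <+: ε := by
  obtain ⟨μ, ⟨hμ, hμε⟩, hmin⟩ :=
    exists_minimalFor_of_wellFoundedLT (fun τ => τ ∈ X ∧ τ <+: ε) List.length
      ⟨ε, hε, List.prefix_refl ε⟩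
  exact ⟨μ, ⟨hμ, fun τ hτ hτμ => hτμ.eq_of_length_le
    (hmin ⟨hτ, hτμ.trans hμε⟩ hτμ.length_le)⟩, hμε⟩

lemma minimalPaths_eq_of_prefix (hγ : γ ∈ minimalPaths X) (hμ : μ ∈ minimalPaths X)
    (hγε : γ <+: ε) (hμε : μ <+: ε) : γ = μ := by
  rcases List.prefix_or_prefix_of_prefix hγε hμε with h | h
  · exact hμ.2 γ hγ.1 h
  · exact (hγ.2 μ hμ.1 h).symm

end MinimalPaths

variable {G V E : Type*} [Group G] [MulAction G V] [MulAction G E]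
  {U : SelfSimilarUltragraph G V E}

lemma length_act (g : G) (l : List E) : (U.act g l).length = l.length := by
  induction l generalizing g with
  | nil => rfl
  | cons e l ih => rw [act_cons, List.length_cons, List.length_cons, ih]

lemma minimalPaths_SFIn (A : Set V) (g : G) :
    minimalPaths (U.SFIn A g) = {γ ∈ minimalPaths (U.SF g) | U.pathRng γ ⊆ A} := by
  ext γ
  constructor
  · rintro ⟨⟨hγ, hγA⟩, hmin⟩
    refine ⟨⟨hγ, fun τ hτ hτγ => hmin τ ⟨hτ, ?_⟩ hτγ⟩, hγA⟩
    obtain ⟨μ, rfl⟩ := hτγ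
    rwa [Ultragraph.pathRng_append hτ.1] at hγA
  · rintro ⟨⟨hγ, hmin⟩, hγA⟩
    exact ⟨⟨hγ, hγA⟩, fun τ hτ => hmin τ hτ.1⟩

lemma minimalPaths_SFIn_mono {A B : Set V} (hAB : A ⊆ B) (g : G) :
    minimalPaths (U.SFIn A g) ⊆ minimalPaths (U.SFIn B g) := by
  rw [minimalPaths_SFIn, minimalPaths_SFIn]
  exact fun γ hγ => ⟨hγ.1, hγ.2.trans hAB⟩

lemma minimalPaths_SFIn_empty (g : G) : minimalPaths (U.SFIn ∅ g) = ∅ := by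
  refine Set.eq_empty_of_forall_notMem fun γ ⟨⟨hγ, hrng⟩, _⟩ => ?_
  obtain ⟨e, l, rfl⟩ := List.exists_cons_of_ne_nil hγ.1
  exact hrng rfl

lemma minimalPaths_SFIn_union_subset (A B : Set V) (g : G) :
    minimalPaths (U.SFIn (A ∪ B) g) ⊆ minimalPaths (U.SFIn A g) ∪ minimalPaths (U.SFIn B g) := by
  intro γ hγ
  obtain ⟨e, l, rfl⟩ := List.exists_cons_of_ne_nil hγ.1.1.1
  simp only [minimalPaths_SFIn, Ultragraph.pathRng, Set.mem_ofPred_eq, Set.mem_union,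
    Set.singleton_subset_iff] at hγ ⊢
  exact and_or_left.1 hγ

lemma forall_gen_finite_minimalPaths_iff (g : G) :
    (∀ A, U.Gen A → (minimalPaths (U.SFIn A g)).Finite) ↔
      (∀ v, (minimalPaths (U.SFIn {v} g)).Finite) ∧
        ∀ e, (minimalPaths (U.SFIn (U.src e) g)).Finite := by
  refine ⟨fun h => ⟨fun v => h _ (.singleton v), fun e => h _ (.source e)⟩, ?_⟩
  rintro ⟨hv, he⟩ A hA
  induction hA with
  | empty => rw [minimalPaths_SFIn_empty]; exact Set.finite_empty
  | singleton v => exact hv v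
  | source e => exact he e
  | inter _ _ hA _ => exact hA.subset (minimalPaths_SFIn_mono Set.inter_subset_left g)
  | diff _ _ hA _ => exact hA.subset (minimalPaths_SFIn_mono Set.sdiff_subset g)
  | union _ _ hA hB => exact (hA.union hB).subset (minimalPaths_SFIn_union_subset _ _ g)

lemma valid_pathSrc {γ : List E} (hne : γ ≠ []) (hγ : U.IsPath γ) :
    U.Valid γ (U.pathSrc γ) 1 γ :=
  ⟨hγ, hγ, U.gen_pathSrc hne, Ultragraph.pathSrc_nonempty hne, by rw [one_smul, Set.inter_self]⟩

namespace Semi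

variable {α β γ ε η : List E} {A C D : Set V} {g : G} {s e f : Semi U} {x y : List E × V × G}

lemma isIdempotentElem_iff_rel : IsIdempotentElem s ↔ ∀ x y, s.Rel x y → x = y := by
  constructor
  · intro hs x y hxy
    have hyx : s.Rel y x := by rwa [← star_eq_self hs, rel_star]
    have hyy : (s * s).Rel y y := (rel_mul _ _ _ _).2 ⟨x, hyx, hxy⟩
    rw [hs.eq] at hyy
    exact rel_inj hxy hyy
  · intro h
    refine rel_ext fun x z => ?_
    rw [rel_mul]
    constructor
    · rintro ⟨y, hxy, hyz⟩
      rwa [h x y hxy]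
    · intro hxz
      obtain rfl := h x z hxz
      exact ⟨x, hxz, hxz⟩

lemma rel_elt_one (h : U.Valid η C 1 η) :
    (elt η C 1 η h).Rel x y ↔ x = y ∧ ∃ ε, x.1 = η ++ ε ∧ hd U ε x.2.1 ∈ C := by
  obtain ⟨l, v, k⟩ := x
  constructor
  · rintro ⟨ε, rfl, hC, rfl⟩
    exact ⟨by simp [act_one, coc_one], ε, rfl, by simpa using hC⟩
  · rintro ⟨rfl, ε, rfl, hC⟩
    exact ⟨ε, rfl, by simpa using hC, by simp [act_one, coc_one]⟩

lemma isIdempotentElem_elt_iff (h : U.Valid α A g β) :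
    IsIdempotentElem (elt α A g β h) ↔ α = β ∧ g = 1 := by
  constructor
  · intro hid
    obtain ⟨v, hv⟩ := h.nonempty
    have hbase := isIdempotentElem_iff_rel.1 hid _ _
      (rel_base h (v := g⁻¹ • v) (by rwa [smul_inv_smul]))
    simp only [Prod.mk.injEq] at hbase
    exact ⟨hbase.1.symm, hbase.2.2.symm⟩
  · rintro ⟨rfl, rfl⟩
    exact isIdempotentElem_iff_rel.2 fun x y hxy => ((rel_elt_one h).1 hxy).1

lemma exists_eq_elt_one (he : IsIdempotentElem e) (h0 : e ≠ 0) :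
    ∃ (η : List E) (C : Set V) (h : U.Valid η C 1 η), e = elt η C 1 η h := by
  cases e with
  | zero => exact absurd rfl h0
  | elt α A g β h =>
    obtain ⟨rfl, rfl⟩ := (isIdempotentElem_elt_iff h).1 he
    exact ⟨α, A, h, rfl⟩

lemma elt_ne_zero (h : U.Valid α A g β) : elt α A g β h ≠ 0 := nofun

lemma ne_zero_iff_exists_rel : s ≠ 0 ↔ ∃ x y, s.Rel x y := by
  constructor
  · intro h0
    cases s with
    | zero => exact absurd rfl h0
    | elt α A g β h =>
      obtain ⟨v, hv⟩ := h.nonempty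
      exact ⟨_, _, rel_base h (v := g⁻¹ • v) (by rwa [smul_inv_smul])⟩
  · rintro ⟨x, y, hxy⟩ rfl
    exact hxy

lemma mul_ne_zero_iff_exists_rel (he : IsIdempotentElem e) (hf : IsIdempotentElem f) :
    e * f ≠ 0 ↔ ∃ x, e.Rel x x ∧ f.Rel x x := by
  simp only [ne_zero_iff_exists_rel, rel_mul]
  constructor
  · rintro ⟨x, z, y, hf', he'⟩
    obtain rfl := isIdempotentElem_iff_rel.1 hf x y hf'
    obtain rfl := isIdempotentElem_iff_rel.1 he x z he'
    exact ⟨x, he', hf'⟩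
  · rintro ⟨x, he', hf'⟩
    exact ⟨x, x, x, hf', he'⟩

lemma mem_idempotentsBelow_iff_rel :
    e ∈ idempotentsBelow s ↔ IsIdempotentElem e ∧ ∀ x, e.Rel x x → s.Rel x x := by
  rw [mem_idempotentsBelow]
  refine and_congr_right fun he => ⟨fun h x hx => ?_, fun h => rel_ext fun x z => ?_⟩
  · obtain ⟨y, hxy, hyx⟩ := (rel_mul s e x x).1 (by rwa [h])
    rwa [rel_fun hxy hx] at hyx
  · rw [rel_mul]
    constructor
    · rintro ⟨y, hxy, hyz⟩
      obtain rfl := isIdempotentElem_iff_rel.1 he x y hxy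
      rwa [rel_fun hyz (h x hxy)]
    · intro hxz
      obtain rfl := isIdempotentElem_iff_rel.1 he x z hxz
      exact ⟨x, hxz, h x hxz⟩

lemma exists_SFIn_of_rel (h : U.Valid α A g β) (hs : ¬ IsIdempotentElem (elt α A g β h))
    (hη : U.IsPath η) {v : V} {k : G} (hrel : (elt α A g β h).Rel (η, v, k) (η, v, k)) :
    α = β ∧ ∃ ε ∈ U.SFIn A g, η = α ++ ε := by
  obtain ⟨ε, rfl : η = β ++ ε, hA, heq⟩ := hrel
  simp only [Prod.mk.injEq, right_eq_mul] at hA heq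
  obtain ⟨hpath, hv, hcoc⟩ := heq
  obtain ⟨rfl, hact⟩ := List.append_inj' hpath (length_act g ε).symm
  have hε : ε ≠ [] := by
    rintro rfl
    exact hs ((isIdempotentElem_elt_iff h).2 ⟨rfl, hcoc⟩)
  refine ⟨rfl, ε, ⟨⟨hε, List.IsChain.right_of_append hη, hact.symm, hcoc⟩, ?_⟩, rfl⟩
  rwa [pathRng_subset hε v, hact, hv, hd_act]

lemma rel_of_mem_SFIn (h : U.Valid α A g α) (hε : ε ∈ U.SFIn A g) (ζ : List E) (v : V) (k : G) :
    (elt α A g α h).Rel (α ++ ε ++ ζ, v, k) (α ++ ε ++ ζ, v, k) := by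
  obtain ⟨⟨hne, -, hact, hcoc⟩, hA⟩ := hε
  refine ⟨ε ++ ζ, List.append_assoc _ _ _, ?_, ?_⟩
  · rw [hd_append ε ζ v hne v, ← hd_act, hact]
    exact (pathRng_subset hne _ A).1 hA
  · simp [act_append, coc_append, hact, hcoc, act_one, coc_one]

lemma mem_idempotentsBelow_elt_iff (h : U.Valid α A g β)
    (hs : ¬ IsIdempotentElem (elt α A g β h)) (he : U.Valid η C 1 η) :
    elt η C 1 η he ∈ idempotentsBelow (elt α A g β h) ↔
      α = β ∧ ∃ ε ∈ U.SFIn A g, η = α ++ ε := by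
  rw [mem_idempotentsBelow_iff_rel]
  constructor
  · rintro ⟨-, hrel⟩
    obtain ⟨v, hv⟩ := he.nonempty
    exact exists_SFIn_of_rel h hs he.path_left
      (hrel (η, v, 1) ((rel_elt_one he).2 ⟨rfl, [], (List.append_nil η).symm, hv⟩))
  · rintro ⟨rfl, ε, hε, rfl⟩
    refine ⟨(isIdempotentElem_elt_iff he).2 ⟨rfl, rfl⟩, fun ⟨l, v, k⟩ hx => ?_⟩
    obtain ⟨-, ζ, rfl, -⟩ := (rel_elt_one he).1 hx
    exact rel_of_mem_SFIn h hε ζ v k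

lemma exists_prefix_of_mul_ne_zero (hγ : U.Valid γ C 1 γ) (hε : U.Valid ε D 1 ε)
    (h : elt γ C 1 γ hγ * elt ε D 1 ε hε ≠ 0) : ∃ l, γ <+: l ∧ ε <+: l := by
  rw [mul_ne_zero_iff_exists_rel ((isIdempotentElem_elt_iff hγ).2 ⟨rfl, rfl⟩)
    ((isIdempotentElem_elt_iff hε).2 ⟨rfl, rfl⟩)] at h
  obtain ⟨x, hxγ, hxε⟩ := h
  obtain ⟨-, ζ, hζ, -⟩ := (rel_elt_one hγ).1 hxγ
  obtain ⟨-, ξ, hξ, -⟩ := (rel_elt_one hε).1 hxε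
  exact ⟨x.1, ⟨ζ, hζ.symm⟩, ⟨ξ, hξ.symm⟩⟩

lemma mul_pathSrc_ne_zero {ν : List E} (hγ : U.Valid γ (U.pathSrc γ) 1 γ)
    (he : U.Valid (γ ++ ν) C 1 (γ ++ ν)) :
    elt (γ ++ ν) C 1 (γ ++ ν) he * elt γ (U.pathSrc γ) 1 γ hγ ≠ 0 := by
  rw [mul_ne_zero_iff_exists_rel ((isIdempotentElem_elt_iff he).2 ⟨rfl, rfl⟩)
    ((isIdempotentElem_elt_iff hγ).2 ⟨rfl, rfl⟩)]
  obtain ⟨v, hv⟩ := he.nonempty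
  refine ⟨(γ ++ ν, v, 1), (rel_elt_one he).2 ⟨rfl, [], (List.append_nil _).symm, hv⟩,
    (rel_elt_one hγ).2 ⟨rfl, ν, rfl, ?_⟩⟩
  by_cases hν : ν = []
  · subst hν
    simpa only [List.append_nil, hd] using (he.subset hv).1
  · exact (pathRng_subset hν v _).1
      (Ultragraph.pathRng_subset_pathSrc_of_isPath_append he.path_left hν)

lemma isCover_minimalPaths (h : U.Valid α A g α) (hs : ¬ IsIdempotentElem (elt α A g α h)) :
    IsCover (⋃ μ ∈ minimalPaths (U.SFIn A g), {e | ∃ hμ : U.Valid (α ++ μ) _ 1 (α ++ μ),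
        e = elt (α ++ μ) (U.pathSrc (α ++ μ)) 1 (α ++ μ) hμ})
      (idempotentsBelow (elt α A g α h)) := by
  constructor
  · refine Set.iUnion₂_subset fun μ hμ => ?_
    rintro _ ⟨hvalid, rfl⟩
    exact (mem_idempotentsBelow_elt_iff h hs hvalid).2 ⟨rfl, μ, hμ.1, rfl⟩
  · intro e he h0
    obtain ⟨η, C, hη, rfl⟩ := exists_eq_elt_one he.1 h0
    obtain ⟨-, ε, hε, rfl⟩ := (mem_idempotentsBelow_elt_iff h hs hη).1 he
    obtain ⟨μ, hμ, ν, rfl⟩ := exists_minimalPaths_prefix hε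
    simp only [← List.append_assoc] at hη ⊢
    have hvalid : U.Valid (α ++ μ) _ 1 (α ++ μ) :=
      valid_pathSrc (List.append_ne_nil_of_right_ne_nil α hμ.1.1.1)
        (List.IsChain.left_of_append hη.path_left)
    exact ⟨_, Set.mem_biUnion hμ ⟨hvalid, rfl⟩, mul_pathSrc_ne_zero hvalid hη⟩

lemma exists_finite_isCover (hfin : ∀ g : G, g ≠ 1 → ∀ A, U.Gen A →
    (minimalPaths (U.SFIn A g)).Finite) (s : Semi U) :
    ∃ T : Set (Semi U), T.Finite ∧ IsCover T (idempotentsBelow s) := by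
  by_cases hs : IsIdempotentElem s
  · exact ⟨{s}, Set.finite_singleton s, isCover_singleton_idempotentsBelow hs⟩
  cases s with
  | zero => exact absurd (mul_zero (0 : Semi U)) hs
  | elt α A g β h =>
    by_cases hαβ : α = β
    · subst hαβ
      have hg : g ≠ 1 := fun hg => hs ((isIdempotentElem_elt_iff h).2 ⟨rfl, hg⟩)
      refine ⟨_, (hfin g hg A h.gen).biUnion fun μ _ => Set.Subsingleton.finite ?_,
        isCover_minimalPaths h hs⟩
      rintro _ ⟨_, rfl⟩ _ ⟨_, rfl⟩
      rfl
    · refine ⟨∅, Set.finite_empty, Set.empty_subset _, fun e he h0 => ?_⟩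
      obtain ⟨η, C, hη, rfl⟩ := exists_eq_elt_one he.1 h0
      exact absurd ((mem_idempotentsBelow_elt_iff h hs hη).1 he).1 hαβ

lemma finite_minimalPaths_of_isCover (h : U.Valid [] A g []) (hg : g ≠ 1) {T : Set (Semi U)}
    (hT : T.Finite) (hcover : IsCover T (idempotentsBelow (elt [] A g [] h))) :
    (minimalPaths (U.SFIn A g)).Finite := by
  have hs : ¬ IsIdempotentElem (elt [] A g [] h) := fun hid =>
    hg ((isIdempotentElem_elt_iff h).1 hid).2
  have hmeet : ∀ γ ∈ minimalPaths (U.SFIn A g), ∃ f ∈ T, ∃ hγ : U.Valid γ (U.pathSrc γ) 1 γ,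
      elt γ (U.pathSrc γ) 1 γ hγ * f ≠ 0 := by
    intro γ hγ
    have hvalid := valid_pathSrc hγ.1.1.1 hγ.1.1.2.1
    obtain ⟨f, hf, hne⟩ := hcover.2 (elt γ (U.pathSrc γ) 1 γ hvalid)
      ((mem_idempotentsBelow_elt_iff h hs hvalid).2 ⟨rfl, γ, hγ.1, rfl⟩) (elt_ne_zero hvalid)
    exact ⟨f, hf, hvalid, hne⟩
  choose! f hfT hvalid hne using hmeet
  refine Set.Finite.of_injOn (f := f) hfT (fun γ hγ γ' hγ' hff' => ?_) hT
  have hne' := hff' ▸ hne γ' hγ'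
  obtain ⟨η, C, hη, hfη⟩ :=
    exists_eq_elt_one (hcover.1 (hfT γ hγ)).1 (right_ne_zero_of_mul (hne γ hγ))
  obtain ⟨-, ε, hε, rfl : η = ε⟩ :=
    (mem_idempotentsBelow_elt_iff h hs hη).1 (hfη ▸ hcover.1 (hfT γ hγ))
  obtain ⟨μ, hμ, hμη⟩ := exists_minimalPaths_prefix hε
  obtain ⟨l, hγl, hηl⟩ := exists_prefix_of_mul_ne_zero _ hη (hfη ▸ hne γ hγ)
  obtain ⟨l', hγl', hηl'⟩ := exists_prefix_of_mul_ne_zero _ hη (hfη ▸ hne')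
  exact (minimalPaths_eq_of_prefix hγ hμ hγl (hμη.trans hηl)).trans
    (minimalPaths_eq_of_prefix hγ' hμ hγl' (hμη.trans hηl')).symm

theorem t2Space_tightGroupoid_iff_finite_minimalPaths :
    T2Space (TightGroupoid (Semi U)) ↔
      ∀ g : G, g ≠ 1 → ∀ A, U.Gen A → (minimalPaths (U.SFIn A g)).Finite := by
  rw [t2Space_tightGroupoid_iff]
  refine ⟨fun hcover g hg A hA => ?_, exists_finite_isCover⟩
  obtain rfl | hne := A.eq_empty_or_nonempty
  · rw [minimalPaths_SFIn_empty]
    exact Set.finite_empty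
  · have h : U.Valid [] A g [] :=
      ⟨List.isChain_nil, List.isChain_nil, hA, hne, by simp [Ultragraph.pathSrc]⟩
    obtain ⟨T, hT, hcover⟩ := hcover (elt [] A g [] h)
    exact finite_minimalPaths_of_isCover h hg hT hcover

end Semi

end SelfSimilarUltragraph

theorem theorem9p5 {G V E : Type*} [Group G] [MulAction G V] [MulAction G E]
    (U : SelfSimilarUltragraph G V E) :
    (∀ g : G, g ≠ 1 →
      (∀ v : V, (SelfSimilarUltragraph.minimalPaths (U.SFIn {v} g)).Finite) ∧
      (∀ e : E, (SelfSimilarUltragraph.minimalPaths (U.SFIn (U.src e) g)).Finite)) ↔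
    T2Space (InverseSemigroupWithZero.TightGroupoid (SelfSimilarUltragraph.Semi U)) := by
  simp only [SelfSimilarUltragraph.Semi.t2Space_tightGroupoid_iff_finite_minimalPaths,
    SelfSimilarUltragraph.forall_gen_finite_minimalPaths_iff]
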